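/- For a non-constant complex polynomial $P$, let $\mathcal{M}(P)$ denote the uniform probability measure on the multiset of zeros of $P$, i.e. $\mathcal{M}(P)=\frac{1}{\deg P}\sum_{w:\,P(w)=0}\delta_w$, zeros being counted with multiplicity. (For a constant polynomial put $\mathcal{M}(P)=0$; this can occur below only for $n=0$.) **Corollary.** Let $\mu$ be any probability measure on $\mathbb{C}$ and let $(z_i)_{i\ge 1}$ be a (deterministic) sequence of complex numbers which is - $\mu$-distributed: $\frac1n\sum_{i=1}^n\delta_{z_i}\to\mu$ weakly as $n\to\infty$; and - log-Cesàro bounded: the sequence $\frac1n\sum_{i=1}^n\log_+|z_i|$, $n\ge 1$, is bounded, where $\log_+ x=\max(0,\log x)$ and $\log_+0=0$. Let $k\in\mathbb{N}$ and let $X_1,\dots,X_k$ be independent complex-valued random variables having bounded densities $\nu_1,\dots,\nu_k$, respectively, with respect to Lebesgue measure on $\mathbb{C}$. For each $n\in\mathbb{N}$ let $$P_n(z)=\prod_{i=1}^{n}(z-z_i)\cdot\prod_{j=1}^{k}(z-X_j).$$ Then, as $n\to\infty$, $\mathcal{M}(P_n)\to\mu$ in probability, and $\mathcal{M}(P_n^{(\ell)})\to\mu$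 in probability for every $1\le\ell\le k$, where $P_n^{(\ell)}$ is the $\ell$-th derivative. Here $M_n\to\mu$ in probability means that $\mathbf{P}(M_n\notin U)\to 0$ for every neighbourhood $U$ of $\mu$ in the topology of weak convergence. -/

import Mathlib

open MeasureTheory ProbabilityTheory Filter Topology Polynomial

noncomputable section

/-- The uniform probability measure `(1 / #s) ∑_{a ∈ s} δ_a` on a nonempty finite multiset `s` of
complex numbers, points being counted with multiplicity (the zero measure if `s` is empty).
Finite measures carry the topology of weak convergence. -/
def uniformOnMultiset (s : Multiset ℂ) : FiniteMeasure ℂ :=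
  ((s.card : NNReal)⁻¹) • (s.map fun a => (diracProba a).toFiniteMeasure).sum

/-- The uniform probability measure on the multiset of zeros of a complex polynomial. -/
def zeroMeasure (p : ℂ[X]) : FiniteMeasure ℂ := uniformOnMultiset p.roots

/-- The sequence `z` is `μ`-distributed: the empirical measures of its first `n` terms
converge weakly to `μ`. -/
def IsDistributedAs (z : ℕ → ℂ) (μ : ProbabilityMeasure ℂ) : Prop :=
  Tendsto (fun n : ℕ => uniformOnMultiset ((Multiset.range n).map z)) atTop
    (𝓝 μ.toFiniteMeasure)

/-- The sequence `z` is log-Cesàro bounded: the Cesàro means of `log₊ |z i|` are bounded. -/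
def LogCesaroBounded (z : ℕ → ℂ) : Prop :=
  ∃ C : ℝ, ∀ n : ℕ, (1 / (n : ℝ)) * ∑ i ∈ Finset.range n, Real.posLog ‖z i‖ ≤ C

/-- `f` is a bounded density (with respect to the Lebesgue measure on `ℂ`) of the
random variable `Y`. -/
structure HasBoundedDensity {Ω : Type*} [MeasurableSpace Ω] (P : Measure Ω)
    (Y : Ω → ℂ) (f : ℂ → ℝ) : Prop where
  measurable : Measurable f
  nonneg : ∀ w, 0 ≤ f w
  bounded : ∃ C : ℝ, ∀ w, f w ≤ C
  law_eq : P.map Y = (volume : Measure ℂ).withDensity fun w => ENNReal.ofReal (f w)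

/-- Convergence in probability of random elements of a topological space to a deterministic
point: every neighbourhood of the limit is left only with probability tending to `0`. -/
def TendstoInProbability {Ω E : Type*} [MeasurableSpace Ω] [TopologicalSpace E]
    (P : Measure Ω) (M : ℕ → Ω → E) (m : E) : Prop :=
  ∀ U ∈ 𝓝 m, Tendsto (fun n : ℕ => P {ω | M n ω ∉ U}) atTop (𝓝 0)

/-- The random polynomial whose zeros are the first `n` terms of `z` together with
`X 0, …, X (k - 1)`. -/
def addedZerosPoly {Ω : Type*} {k : ℕ} (z : ℕ → ℂ) (X : Fin k → Ω → ℂ) (n : ℕ) (ω : Ω) :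
    ℂ[X] :=
  (∏ i ∈ Finset.range n, (Polynomial.X - C (z i))) * ∏ j : Fin k, (Polynomial.X - C (X j ω))

end

noncomputable section

/-! ### Local integrability of the logarithmic kernel -/

/-! The argument compares logarithmic potentials. Write `q` for the product over the deterministic
points, `p` for `q` with the random roots added, `d` for the `ℓ`-th derivative of `p`, and `N` for
the degree of `p`. If the potentials of the roots of `d` and of `p` differ by `o(N)` off a small
part of a large disc, then both root sets have nearly the same averages against test functions. The
roots of `p` are the given points plus `k` others, so these averages tend to those of `μ`.

Closeness of potentials means that `log ‖d / p‖` is `o(N)`. From above, `‖d / p‖` is at most the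
`ℓ`-th power of the sum of `‖z - w‖⁻¹` over roots `w`, which Markov's inequality bounds by `N ^ 2`
off a set of small area (`volume_setOf_logPot_le`). From below, `d` at a fixed point is affine in
each random root. A bounded density prevents such a root from lying too near the zero of the affine
map, and induction on `k` makes `‖d‖ ≥ δ * ‖q‖` likely
(`exists_pi_measure_eval_iterate_derivative_lt_le`). Fubini and Markov turn this into a statement
about area.

To pass from potentials to sums of `f`, no Laplacian is taken: a difference of two circle averages
of the logarithm is a compactly supported bump, and averaging is self-adjoint, so `f` smoothed by
this bump is a potential integrated against a continuous function (`integral_mul_logBump`). Small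
exceptional sets are harmless because logarithms are uniformly integrable. Mass at infinity is
controlled by logarithmic moments, which pass to the derivative through Mahler's measure
(`sum_posLog_roots_iterate_derivative_le`). -/

lemma integrable_indicator_ball_norm_inv :
    Integrable ((Metric.ball (0 : ℂ) 1).indicator fun z => ‖z‖⁻¹) := by
  rw [integrable_indicator_iff Metric.isOpen_ball.measurableSet]
  rw [integrableOn_fun_norm_addHaar (μ := (volume : Measure ℂ)) (f := fun y : ℝ => y⁻¹)]
  have : IntegrableOn (fun _ : ℝ => (1 : ℝ)) (Set.Ioo 0 1) := by
    simp
  refine this.congr_fun (fun y hy => ?_) measurableSet_Ioo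
  simp [Complex.finrank_real_complex, hy.1.ne']

lemma norm_sub_inv_le_one_add_indicator (z w : ℂ) :
    ‖z - w‖⁻¹ ≤ 1 + (Metric.ball (0 : ℂ) 1).indicator (fun z => ‖z‖⁻¹) (z - w) := by
  by_cases h : z - w ∈ Metric.ball (0 : ℂ) 1
  · rw [Set.indicator_of_mem h]; simp
  · rw [Set.indicator_of_notMem h, add_zero]
    simp only [Metric.mem_ball, dist_zero_right, not_lt] at h
    exact inv_le_one_of_one_le₀ h

lemma integrableOn_norm_sub_inv (R : ℝ) (w : ℂ) :
    IntegrableOn (fun z : ℂ => ‖z - w‖⁻¹) (Metric.closedBall 0 R) := by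
  have h : IntegrableOn (fun z : ℂ => 1 + (Metric.ball (0 : ℂ) 1).indicator (fun z => ‖z‖⁻¹)
      (z - w)) (Metric.closedBall 0 R) :=
    (integrableOn_const (measure_closedBall_lt_top).ne).add
      (integrable_indicator_ball_norm_inv.comp_sub_right w).integrableOn
  refine h.mono' (by fun_prop) (Eventually.of_forall fun z => ?_)
  rw [Real.norm_of_nonneg (by positivity)]
  exact norm_sub_inv_le_one_add_indicator z w

lemma exists_setIntegral_norm_sub_inv_le (R : ℝ) :
    ∃ c : ℝ, 0 ≤ c ∧ ∀ w : ℂ, ∫ z in Metric.closedBall (0 : ℂ) R, ‖z - w‖⁻¹ ≤ c := by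
  set h : ℂ → ℝ := (Metric.ball (0 : ℂ) 1).indicator (fun z => ‖z‖⁻¹) with hh
  have hnn : ∀ z, 0 ≤ h z := fun z => Set.indicator_nonneg (fun _ _ => by positivity) z
  refine ⟨volume.real (Metric.closedBall (0 : ℂ) R) + ∫ z, h z,
    add_nonneg measureReal_nonneg (integral_nonneg hnn), fun w => ?_⟩
  have hi : Integrable (fun z => h (z - w)) := integrable_indicator_ball_norm_inv.comp_sub_right w
  calc ∫ z in Metric.closedBall (0 : ℂ) R, ‖z - w‖⁻¹
      ≤ ∫ z in Metric.closedBall (0 : ℂ) R, (1 + h (z - w)) := by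
        refine setIntegral_mono (integrableOn_norm_sub_inv R w) ?_
          fun z => norm_sub_inv_le_one_add_indicator z w
        exact (integrableOn_const (measure_closedBall_lt_top).ne).add hi.integrableOn
    _ = volume.real (Metric.closedBall (0 : ℂ) R)
          + ∫ z in Metric.closedBall (0 : ℂ) R, h (z - w) := by
        have hc : IntegrableOn (fun _ : ℂ => (1 : ℝ)) (Metric.closedBall (0 : ℂ) R) :=
          integrableOn_const (measure_closedBall_lt_top).ne
        rw [integral_add hc hi.integrableOn]
        simp
    _ ≤ volume.real (Metric.closedBall (0 : ℂ) R) + ∫ z, h (z - w) := by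
        refine add_le_add le_rfl (setIntegral_le_integral hi ?_)
        exact Eventually.of_forall fun z => hnn (z - w)
    _ = _ := by rw [integral_sub_right_eq_self h w]

/-- Apply `log t ≤ t - 1` at `t = θ / x`. The parameter `θ` makes the singular term as small as
desired; its cost `|log θ|` is later multiplied by the area of a small set. -/
lemma abs_log_le_posLog_add {x θ : ℝ} (hx : 0 ≤ x) (hθ : 0 < θ) :
    |Real.log x| ≤ Real.posLog x + |Real.log θ| + θ * x⁻¹ := by
  have hp : 0 ≤ Real.posLog x := Real.posLog_nonneg
  have h2 := abs_nonneg (Real.log θ)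
  rcases hx.eq_or_lt with rfl | hx
  · simp
  have h1 : Real.log (θ / x) ≤ θ / x - 1 := Real.log_le_sub_one_of_pos (by positivity)
  rw [Real.log_div hθ.ne' hx.ne'] at h1
  have h3 : 0 ≤ θ / x := by positivity
  have h4 : Real.log x ≤ Real.posLog x := le_max_right _ _
  rw [abs_le, ← div_eq_mul_inv]
  constructor
  · have := neg_abs_le (Real.log θ); linarith
  · linarith

lemma posLog_norm_sub_le (z w : ℂ) :
    Real.posLog ‖z - w‖ ≤ Real.log 2 + Real.posLog ‖z‖ + Real.posLog ‖w‖ := by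
  have h := Real.posLog_norm_add_le z (-w)
  rw [norm_neg, ← sub_eq_add_neg] at h
  linarith

lemma abs_log_norm_sub_le {z w : ℂ} {R θ : ℝ} (hz : z ∈ Metric.closedBall (0 : ℂ) R)
    (hθ : 0 < θ) :
    |Real.log ‖z - w‖| ≤ Real.log 2 + Real.posLog R + |Real.log θ| + Real.posLog ‖w‖
      + θ * ‖z - w‖⁻¹ := by
  have h1 := abs_log_le_posLog_add (norm_nonneg (z - w)) hθ
  have h2 := posLog_norm_sub_le z w
  have h3 : Real.posLog ‖z‖ ≤ Real.posLog R :=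
    Real.posLog_le_posLog (norm_nonneg z) (by simpa using hz)
  linarith

@[fun_prop]
lemma measurable_log_norm_sub (w : ℂ) : Measurable fun z : ℂ => Real.log ‖z - w‖ := by
  fun_prop

lemma integrableOn_log_norm_sub (R : ℝ) (w : ℂ) :
    IntegrableOn (fun z : ℂ => Real.log ‖z - w‖) (Metric.closedBall 0 R) := by
  have h : IntegrableOn (fun z : ℂ => Real.log 2 + Real.posLog R + |Real.log 1| + Real.posLog ‖w‖
      + 1 * ‖z - w‖⁻¹) (Metric.closedBall 0 R) :=
    (integrableOn_const (measure_closedBall_lt_top).ne).add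
      ((integrableOn_norm_sub_inv R w).const_mul 1)
  refine h.mono' (measurable_log_norm_sub w).aestronglyMeasurable ?_
  filter_upwards [ae_restrict_mem Metric.isClosed_closedBall.measurableSet] with z hz
  exact abs_log_norm_sub_le hz one_pos

lemma locallyIntegrable_of_forall_closedBall {L : ℂ → ℝ}
    (h : ∀ R : ℝ, IntegrableOn L (Metric.closedBall 0 R)) : LocallyIntegrable L := by
  rw [locallyIntegrable_iff]
  intro K hK
  obtain ⟨R, hR⟩ := hK.isBounded.subset_closedBall 0
  exact (h R).mono_set hR

/-- Uniform integrability of the kernels: choosing `θ` and then the area of `S` small makes the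
bound small, and `w` enters only through `log₊ ‖w‖`. -/
lemma setIntegral_abs_log_norm_sub_le {R θ c : ℝ} (hθ : 0 < θ)
    (hc : ∀ w : ℂ, ∫ z in Metric.closedBall (0 : ℂ) R, ‖z - w‖⁻¹ ≤ c)
    {S : Set ℂ} (hSR : S ⊆ Metric.closedBall 0 R) (hS : MeasurableSet S) (w : ℂ) :
    ∫ z in S, |Real.log ‖z - w‖| ≤
      (Real.log 2 + Real.posLog R + |Real.log θ| + Real.posLog ‖w‖) * volume.real S + θ * c := by
  have hS' : volume S ≠ ⊤ := ((measure_mono hSR).trans_lt measure_closedBall_lt_top).ne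
  have hi := (integrableOn_norm_sub_inv R w)
  calc ∫ z in S, |Real.log ‖z - w‖|
      ≤ ∫ z in S, ((Real.log 2 + Real.posLog R + |Real.log θ| + Real.posLog ‖w‖)
        + θ * ‖z - w‖⁻¹) := by
        refine setIntegral_mono_on ((integrableOn_log_norm_sub R w).mono_set hSR).abs ?_ hS
          fun z hz => abs_log_norm_sub_le (hSR hz) hθ
        exact (integrableOn_const hS').add ((hi.mono_set hSR).const_mul θ)
    _ = (Real.log 2 + Real.posLog R + |Real.log θ| + Real.posLog ‖w‖) * volume.real S
          + θ * ∫ z in S, ‖z - w‖⁻¹ := by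
        have hc : ∀ a : ℝ, IntegrableOn (fun _ : ℂ => a) S := fun a => integrableOn_const hS'
        rw [integral_add (hc _) ((hi.mono_set hSR).const_mul θ),
          integral_const_mul]
        simp [mul_comm]
    _ ≤ _ := by
        gcongr
        refine (setIntegral_mono_set hi (Eventually.of_forall fun z => by positivity)
          hSR.eventuallyLE).trans (hc w)

/-! ### Circle averages -/

/-- Circle averaging is self-adjoint, by Fubini, translation invariance and the symmetry of the
circle under negation. -/
lemma integral_mul_circleAverage {f L : ℂ → ℝ} (hf : Continuous f) (hfc : HasCompactSupport f)
    (hL : Measurable L) (hLi : ∀ R : ℝ, IntegrableOn L (Metric.closedBall 0 R)) (r : ℝ) :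
    ∫ c, f c * Real.circleAverage L c r = ∫ z, Real.circleAverage f z r * L z := by
  obtain ⟨T, hT⟩ := hfc.isCompact.isBounded.subset_closedBall 0
  obtain ⟨B, hB⟩ := hfc.exists_bound_of_continuous hf
  have hB0 : 0 ≤ B := (norm_nonneg _).trans (hB 0)
  have hfT : ∀ z : ℂ, T < ‖z‖ → f z = 0 := fun z hz => by
    by_contra h
    have := hT (subset_tsupport f h)
    simp at this; linarith
  set e : ℝ → ℂ := circleMap 0 r with he
  have hec : Continuous e := continuous_circleMap 0 r
  have hcm : ∀ c θ, circleMap c r θ = c + e θ := fun c θ => by simp [he, circleMap]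
  have hen : ∀ θ, ‖e θ‖ = |r| := fun θ => by simp [he]
  set I : Measure ℝ := volume.restrict (Set.Ioc 0 (2 * Real.pi)) with hI
  have hG : Integrable (fun p : ℂ × ℝ => f (p.1 - e p.2) * L p.1) (volume.prod I) := by
    have h1 : Integrable (fun z => B * (Metric.closedBall (0 : ℂ) (T + |r|)).indicator
        (fun z => |L z|) z) :=
      ((integrable_indicator_iff Metric.isClosed_closedBall.measurableSet).2
        (hLi _).abs).const_mul B
    refine (h1.comp_fst I).mono' ?_ (Eventually.of_forall fun p => ?_)
    · exact Measurable.aestronglyMeasurable (by fun_prop)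
    · by_cases hp : p.1 ∈ Metric.closedBall (0 : ℂ) (T + |r|)
      · simp only [Set.indicator_of_mem hp, norm_mul]
        gcongr
        · exact hB _
        · simp
      · have : f (p.1 - e p.2) = 0 := hfT _ <| by
          simp only [Metric.mem_closedBall, dist_zero_right, not_le] at hp
          have := norm_sub_norm_le p.1 (e p.2)
          rw [hen] at this; linarith
        rw [this]; simp [Set.indicator_of_notMem hp]
  -- Used with `F` the norm, to transfer integrability, and with `F` the identity.
  have htr : ∀ θ, ∀ F : ℝ → ℝ, ∫ c, F (f c * L (c + e θ)) = ∫ z, F (f (z - e θ) * L z) :=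
    fun θ F => by
      simpa using (integral_add_right_eq_self (fun z => F (f (z - e θ) * L z)) (e θ))
  have hF : Integrable (fun p : ℂ × ℝ => f p.1 * L (p.1 + e p.2)) (volume.prod I) := by
    rw [integrable_prod_iff' (Measurable.aestronglyMeasurable (by fun_prop))]
    constructor
    · filter_upwards [hG.prod_left_ae] with θ hθ
      simpa using hθ.comp_add_right (e θ)
    · refine hG.norm.integral_prod_right.congr (Eventually.of_forall fun θ => ?_)
      exact (htr θ _).symm
  have h2 : (0 : ℝ) ≤ 2 * Real.pi := by positivity
  calc ∫ c, f c * Real.circleAverage L c r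
      = ∫ c, (2 * Real.pi)⁻¹ * ∫ θ, f c * L (c + e θ) ∂I := by
        congr 1; ext c
        rw [Real.circleAverage_def, intervalIntegral.integral_of_le h2, integral_const_mul]
        simp only [hcm, smul_eq_mul]; ring
    _ = (2 * Real.pi)⁻¹ * ∫ θ, (∫ c, f c * L (c + e θ)) ∂I := by
        rw [integral_const_mul, integral_integral_swap (f := fun c θ => f c * L (c + e θ)) hF]
    _ = (2 * Real.pi)⁻¹ * ∫ θ, (∫ z, f (z - e θ) * L z) ∂I := by
        congr 2; ext θ; exact htr θ id
    _ = ∫ z, (2 * Real.pi)⁻¹ * ∫ θ, f (z - e θ) * L z ∂I := by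
        rw [integral_const_mul, ← integral_integral_swap (f := fun z θ => f (z - e θ) * L z) hG]
    _ = _ := by
        congr 1; ext z
        rw [← Real.circleAverage_neg_radius, Real.circleAverage_def,
          intervalIntegral.integral_of_le h2, integral_mul_const]
        have : ∀ θ, circleMap z (-r) θ = z - e θ := fun θ => by
          simp [he, circleMap, sub_eq_add_neg]
        simp only [this, smul_eq_mul]; ring

/-! ### A radial bump function that is a difference of circle averages of the logarithm -/

/-- The difference of the averages of `log ‖· - w‖` over the circles of radii `r` and `r / 2`
around a point at displacement `v` from `w`. -/
def logBump (r : ℝ) (v : ℂ) : ℝ :=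
  Real.log 2 + Real.posLog (r⁻¹ * ‖v‖) - Real.posLog (2 * (r⁻¹ * ‖v‖))

@[fun_prop]
lemma continuous_logBump (r : ℝ) : Continuous (logBump r) := by
  unfold logBump
  have := Real.continuous_posLog
  fun_prop

lemma logBump_nonneg (r : ℝ) (v : ℂ) : 0 ≤ logBump r v := by
  have h := Real.posLog_mul (x := 2) (y := r⁻¹ * ‖v‖)
  have h2 : Real.posLog 2 = Real.log 2 := Real.posLog_eq_log (by norm_num)
  unfold logBump; linarith

/-- When the pole is outside both circles the logarithm is harmonic inside them, so the two averages
agree. -/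
lemma logBump_eq_zero {r : ℝ} (hr : 0 < r) {v : ℂ} (hv : r ≤ ‖v‖) : logBump r v = 0 := by
  have h1 : 1 ≤ r⁻¹ * ‖v‖ := by
    rw [inv_mul_eq_div, le_div_iff₀ hr]; linarith
  unfold logBump
  generalize r⁻¹ * ‖v‖ = x at h1
  rw [Real.posLog_eq_log (by rw [abs_of_pos] <;> linarith),
    Real.posLog_eq_log (by rw [abs_of_pos] <;> linarith), Real.log_mul (by norm_num) (by linarith)]
  ring

lemma hasCompactSupport_logBump {r : ℝ} (hr : 0 < r) : HasCompactSupport (logBump r) := by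
  refine HasCompactSupport.of_support_subset_isCompact (isCompact_closedBall (0 : ℂ) r) ?_
  intro v hv
  by_contra h
  exact hv (logBump_eq_zero hr (by simpa using (not_le.1 (by simpa using h)).le))

lemma integral_logBump_pos {r : ℝ} (hr : 0 < r) : 0 < ∫ v, logBump r v := by
  refine (continuous_logBump r).integral_pos_of_hasCompactSupport_nonneg_nonzero
    (hasCompactSupport_logBump hr) (logBump_nonneg r) (x := 0) ?_
  simpa [logBump] using (Real.log_pos one_lt_two).ne'

lemma circleAverage_log_sub_circleAverage_log {r : ℝ} (hr : 0 < r) (c w : ℂ) :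
    Real.circleAverage (fun z => Real.log ‖z - w‖) c r
      - Real.circleAverage (fun z => Real.log ‖z - w‖) c (r / 2) = logBump r (c - w) := by
  rw [circleAverage_log_norm_sub_const_eq_log_radius_add_posLog hr.ne',
    circleAverage_log_norm_sub_const_eq_log_radius_add_posLog (by positivity),
    Real.log_div hr.ne' two_ne_zero, logBump]
  have : (r / 2)⁻¹ * ‖c - w‖ = 2 * (r⁻¹ * ‖c - w‖) := by field_simp
  rw [this]; ring

lemma continuous_circleAverage_center {f : ℂ → ℝ} (hf : Continuous f) (r : ℝ) :
    Continuous fun z => Real.circleAverage f z r := by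
  have h : Continuous fun z => ∫ θ in 0..2 * Real.pi, f (circleMap z r θ) := by
    apply intervalIntegral.continuous_parametric_intervalIntegral_of_continuous'
    unfold circleMap Function.uncurry
    fun_prop
  exact h.const_smul (2 * Real.pi)⁻¹

lemma hasCompactSupport_circleAverage_center {f : ℂ → ℝ} (hfc : HasCompactSupport f) (r : ℝ) :
    HasCompactSupport fun z => Real.circleAverage f z r := by
  obtain ⟨T, hT⟩ := hfc.isCompact.isBounded.subset_closedBall 0
  refine HasCompactSupport.of_support_subset_isCompact
    (isCompact_closedBall (0 : ℂ) (T + |r|)) fun z hz => ?_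
  by_contra h
  refine hz ?_
  have h0 : ∀ θ, f (circleMap z r θ) = 0 := fun θ => by
    by_contra h'
    have h1 := hT (subset_tsupport f h')
    have h2 : ‖z‖ ≤ ‖circleMap z r θ‖ + |r| := by
      have := norm_sub_le (circleMap z r θ) (circleMap 0 r θ)
      simpa [circleMap] using this
    simp at h1 h
    linarith
  simp [Real.circleAverage_def, h0]

/-- The difference of the averages of `f` over the circles of radii `r` and `r / 2`. -/
def circleDiff (f : ℂ → ℝ) (r : ℝ) (z : ℂ) : ℝ :=
  Real.circleAverage f z r - Real.circleAverage f z (r / 2)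

lemma continuous_circleDiff {f : ℂ → ℝ} (hf : Continuous f) (r : ℝ) :
    Continuous (circleDiff f r) :=
  (continuous_circleAverage_center hf r).sub (continuous_circleAverage_center hf _)

lemma hasCompactSupport_circleDiff {f : ℂ → ℝ} (hfc : HasCompactSupport f) (r : ℝ) :
    HasCompactSupport (circleDiff f r) := by
  unfold circleDiff
  simp only [sub_eq_add_neg]
  exact (hasCompactSupport_circleAverage_center hfc r).add
    (hasCompactSupport_circleAverage_center hfc (r / 2)).neg

lemma integrable_mul_of_hasCompactSupport {φ L : ℂ → ℝ} (hφ : Continuous φ)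
    (hφc : HasCompactSupport φ) (hLi : ∀ R : ℝ, IntegrableOn L (Metric.closedBall 0 R)) :
    Integrable fun z => φ z * L z := by
  simpa using (locallyIntegrable_of_forall_closedBall hLi).integrable_smul_left_of_hasCompactSupport
    hφ hφc

/-- The averages move from the logarithm to `f`. This replaces integration by parts and needs no
smoothness of `f`. -/
lemma integral_mul_logBump {f : ℂ → ℝ} (hf : Continuous f) (hfc : HasCompactSupport f) {r : ℝ}
    (hr : 0 < r) (w : ℂ) :
    ∫ c, f c * logBump r (c - w) = ∫ z, circleDiff f r z * Real.log ‖z - w‖ := by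
  have hL := measurable_log_norm_sub w
  have hLi := fun R => integrableOn_log_norm_sub R w
  have hc : ∀ ρ : ℝ, 0 < ρ →
      Integrable fun c => f c * Real.circleAverage (fun z => Real.log ‖z - w‖) c ρ := by
    intro ρ hρ
    simp_rw [circleAverage_log_norm_sub_const_eq_log_radius_add_posLog hρ.ne']
    have := Real.continuous_posLog
    refine Continuous.integrable_of_hasCompactSupport (by fun_prop) ?_
    exact hfc.mul_right
  calc ∫ c, f c * logBump r (c - w)
      = (∫ c, f c * Real.circleAverage (fun z => Real.log ‖z - w‖) c r)
        - ∫ c, f c * Real.circleAverage (fun z => Real.log ‖z - w‖) c (r / 2) := by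
        rw [← integral_sub (hc r hr) (hc _ (by positivity))]
        simp_rw [← mul_sub, circleAverage_log_sub_circleAverage_log hr]
    _ = (∫ z, Real.circleAverage f z r * Real.log ‖z - w‖)
        - ∫ z, Real.circleAverage f z (r / 2) * Real.log ‖z - w‖ := by
        rw [integral_mul_circleAverage hf hfc hL hLi, integral_mul_circleAverage hf hfc hL hLi]
    _ = _ := by
        rw [← integral_sub]
        · simp_rw [← sub_mul]; rfl
        · exact integrable_mul_of_hasCompactSupport (continuous_circleAverage_center hf r)
            (hasCompactSupport_circleAverage_center hfc r) hLi
        · exact integrable_mul_of_hasCompactSupport (continuous_circleAverage_center hf _)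
            (hasCompactSupport_circleAverage_center hfc _) hLi

/-- Normalised bumps are an approximate identity, and `f` is uniformly continuous. -/
lemma exists_logBump_approx {f : ℂ → ℝ} (hf : Continuous f) (hfc : HasCompactSupport f) {η : ℝ}
    (hη : 0 < η) :
    ∃ r > 0, ∀ w, |(∫ v, logBump r v)⁻¹ * (∫ c, f c * logBump r (c - w)) - f w| ≤ η := by
  obtain ⟨r, hr, h⟩ := Metric.uniformContinuous_iff.1
    (hfc.uniformContinuous_of_continuous hf) η hη
  refine ⟨r, hr, fun w => ?_⟩
  set I := ∫ v, logBump r v with hI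
  have hI0 : 0 < I := integral_logBump_pos hr
  have hb : Integrable (fun c => logBump r (c - w)) :=
    ((continuous_logBump r).integrable_of_hasCompactSupport
      (hasCompactSupport_logBump hr)).comp_sub_right w
  have hIw : ∫ c, logBump r (c - w) = I := integral_sub_right_eq_self (logBump r) w
  have hfb : Integrable fun c => f c * logBump r (c - w) :=
    Continuous.integrable_of_hasCompactSupport (by fun_prop) hfc.mul_right
  have key : |∫ c, (f c - f w) * logBump r (c - w)| ≤ η * I := by
    rw [← hIw, ← integral_const_mul, ← Real.norm_eq_abs]
    refine norm_integral_le_of_norm_le (hb.const_mul η) (Eventually.of_forall fun c => ?_)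
    rw [norm_mul, Real.norm_of_nonneg (logBump_nonneg r _)]
    by_cases hc : ‖c - w‖ < r
    · gcongr
      · exact logBump_nonneg r _
      · exact (h (by simpa [dist_eq_norm] using hc)).le
    · rw [logBump_eq_zero hr (not_lt.1 hc)]; simp
  have h2 : ∫ c, (f c - f w) * logBump r (c - w) = (∫ c, f c * logBump r (c - w)) - f w * I := by
    simp_rw [sub_mul]
    rw [integral_sub hfb (hb.const_mul _), integral_const_mul, hIw]
  have h3 : I⁻¹ * (∫ c, f c * logBump r (c - w)) - f w
      = I⁻¹ * ∫ c, (f c - f w) * logBump r (c - w) := by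
    rw [h2]; field_simp
  rw [h3, abs_mul, abs_of_pos (inv_pos.2 hI0), inv_mul_le_iff₀ hI0]
  linarith

/-! ### Logarithmic potentials of multisets -/

/-- The logarithmic potential `∑_{w ∈ s} log ‖z - w‖` of a finite multiset. -/
def logPot (s : Multiset ℂ) (z : ℂ) : ℝ := (s.map fun w => Real.log ‖z - w‖).sum

@[simp] lemma logPot_zero (z : ℂ) : logPot 0 z = 0 := by simp [logPot]

@[simp] lemma logPot_cons (a : ℂ) (s : Multiset ℂ) (z : ℂ) :
    logPot (a ::ₘ s) z = Real.log ‖z - a‖ + logPot s z := by simp [logPot]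

lemma measurable_logPot (s : Multiset ℂ) : Measurable (logPot s) := by
  induction s using Multiset.induction with
  | empty => simp only [funext logPot_zero]; fun_prop
  | cons a s ih => simp only [funext (logPot_cons a s)]; fun_prop

lemma integrableOn_logPot (s : Multiset ℂ) (R : ℝ) :
    IntegrableOn (logPot s) (Metric.closedBall 0 R) := by
  induction s using Multiset.induction with
  | empty => simp only [funext logPot_zero]; simp
  | cons a s ih =>
    simp only [funext (logPot_cons a s)]
    exact (integrableOn_log_norm_sub R a).add ih

lemma sum_map_integral_mul_log {φ : ℂ → ℝ} (hφ : Continuous φ) (hφc : HasCompactSupport φ)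
    (s : Multiset ℂ) :
    (s.map fun w => ∫ z, φ z * Real.log ‖z - w‖).sum = ∫ z, φ z * logPot s z := by
  induction s using Multiset.induction with
  | empty => simp
  | cons a s ih =>
    simp only [Multiset.map_cons, Multiset.sum_cons, ih, logPot_cons, mul_add]
    rw [integral_add]
    · exact integrable_mul_of_hasCompactSupport hφ hφc fun R => integrableOn_log_norm_sub R a
    · exact integrable_mul_of_hasCompactSupport hφ hφc fun R => integrableOn_logPot s R

lemma setIntegral_abs_logPot_le {R θ c : ℝ} (hθ : 0 < θ)
    (hc : ∀ w : ℂ, ∫ z in Metric.closedBall (0 : ℂ) R, ‖z - w‖⁻¹ ≤ c)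
    {S : Set ℂ} (hSR : S ⊆ Metric.closedBall 0 R) (hS : MeasurableSet S) (s : Multiset ℂ) :
    ∫ z in S, |logPot s z| ≤
      ((Real.log 2 + Real.posLog R + |Real.log θ|) * s.card
        + (s.map fun w => Real.posLog ‖w‖).sum) * volume.real S + θ * c * s.card := by
  induction s using Multiset.induction with
  | empty => simp
  | cons a s ih =>
    have h1 := ((integrableOn_log_norm_sub R a).mono_set hSR).abs
    have h2 := ((integrableOn_logPot s R).mono_set hSR).abs
    have h3 : ∫ z in S, |logPot (a ::ₘ s) z| ≤ ∫ z in S, (|Real.log ‖z - a‖| + |logPot s z|) := by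
      refine setIntegral_mono ((integrableOn_logPot _ R).mono_set hSR).abs (h1.add h2) fun z => ?_
      rw [logPot_cons]; exact abs_add_le _ _
    rw [integral_add h1 h2] at h3
    have h4 := setIntegral_abs_log_norm_sub_le hθ hc hSR hS a
    simp only [Multiset.card_cons, Multiset.map_cons, Multiset.sum_cons]
    push_cast
    linarith

lemma abs_sum_map_sub_sum_map_le_sum {f g h : ℂ → ℝ} (H : ∀ w, |f w - g w| ≤ h w)
    (s : Multiset ℂ) : |(s.map f).sum - (s.map g).sum| ≤ (s.map h).sum := by
  induction s using Multiset.induction with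
  | empty => simp
  | cons a s ih =>
    simp only [Multiset.map_cons, Multiset.sum_cons]
    have h1 := H a
    rw [abs_le] at *
    constructor <;> linarith

lemma abs_sum_map_sub_sum_map_le {f g : ℂ → ℝ} {η : ℝ} (h : ∀ w, |f w - g w| ≤ η)
    (s : Multiset ℂ) : |(s.map f).sum - (s.map g).sum| ≤ η * s.card := by
  simpa [mul_comm] using abs_sum_map_sub_sum_map_le_sum (h := fun _ => η) h s

lemma exists_pos_mul_le {A η : ℝ} (hA : 0 ≤ A) (hη : 0 < η) : ∃ x > 0, A * x ≤ η := by
  refine ⟨η / (A + 1), by positivity, ?_⟩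
  rw [mul_div_assoc', div_le_iff₀ (by positivity)]
  nlinarith

/-- If two finite multisets of at most `N` points, with controlled logarithmic moments, have close
logarithmic potentials off a small part of a large disc, then their sums against a continuous
function with compact support are close. -/
lemma exists_abs_sum_sub_sum_le_of_logPot_of_hasCompactSupport {f : ℂ → ℝ} (hf : Continuous f)
    (hfc : HasCompactSupport f) {η K : ℝ} (hη : 0 < η) (hK : 0 ≤ K) :
    ∃ R ε κ : ℝ, 0 < ε ∧ 0 < κ ∧ ∀ (N : ℝ) (s t : Multiset ℂ),
      (s.card : ℝ) ≤ N → (t.card : ℝ) ≤ N →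
      (s.map fun w => Real.posLog ‖w‖).sum ≤ K * N →
      (t.map fun w => Real.posLog ‖w‖).sum ≤ K * N →
      volume.real {z ∈ Metric.closedBall (0 : ℂ) R | ε * N < |logPot s z - logPot t z|} ≤ κ →
      |(s.map f).sum - (t.map f).sum| ≤ η * N := by
  obtain ⟨r, hr, happ⟩ := exists_logBump_approx hf hfc (show 0 < η / 4 by positivity)
  set I := ∫ v, logBump r v with hI
  have hI0 : 0 < I := integral_logBump_pos hr
  set ψ := circleDiff f r with hψ
  have hψc := continuous_circleDiff hf r
  have hψs := hasCompactSupport_circleDiff hfc r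
  obtain ⟨R, hR⟩ := hψs.isCompact.isBounded.subset_closedBall 0
  obtain ⟨M, hM⟩ := hψs.exists_bound_of_continuous hψc
  have hM0 : 0 ≤ M := (norm_nonneg _).trans (hM 0)
  obtain ⟨c, hc0, hc⟩ := exists_setIntegral_norm_sub_inv_le R
  set D := Metric.closedBall (0 : ℂ) R with hD
  set V := volume.real D with hV
  -- `ε` pays for the good part of the disc, `θ` for the logarithmic singularities. `κ` comes after
  -- `θ` because `a` contains `|log θ|`.
  obtain ⟨ε, hε, hε'⟩ := exists_pos_mul_le (A := I⁻¹ * M * V) (η := η / 4) (by positivity)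
    (by positivity)
  obtain ⟨θ, hθ, hθ'⟩ := exists_pos_mul_le (A := I⁻¹ * M * c) (η := η / 16) (by positivity)
    (by positivity)
  set a := Real.log 2 + Real.posLog R + |Real.log θ| with ha
  have ha0 : 0 ≤ a := by
    have := Real.log_pos one_lt_two
    have := Real.posLog_nonneg (x := R)
    positivity
  obtain ⟨κ, hκ, hκ'⟩ := exists_pos_mul_le (A := I⁻¹ * M * (a + K)) (η := η / 16) (by positivity)
    (by positivity)
  refine ⟨R, ε, κ, hε, hκ, fun N s t hs ht hsK htK hbad => ?_⟩
  have hN : 0 ≤ N := (Nat.cast_nonneg _).trans hs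
  set u : ℂ → ℝ := fun z => logPot s z - logPot t z with hu
  have hum : Measurable u := (measurable_logPot s).sub (measurable_logPot t)
  have hui : ∀ ρ, IntegrableOn u (Metric.closedBall 0 ρ) := fun ρ =>
    (integrableOn_logPot s ρ).sub (integrableOn_logPot t ρ)
  set S := {z ∈ D | ε * N < |u z|} with hS
  have hSD : S ⊆ D := Set.sep_subset _ _
  have hSm : MeasurableSet S := Metric.isClosed_closedBall.measurableSet.inter
    (measurableSet_lt measurable_const hum.abs)
  have hbd : ∀ m : Multiset ℂ, (m.card : ℝ) ≤ N →
      (m.map fun w => Real.posLog ‖w‖).sum ≤ K * N →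
      ∫ z in S, |logPot m z| ≤ ((a + K) * κ + θ * c) * N := fun m hm hmK => by
    refine (setIntegral_abs_logPot_le hθ hc hSD hSm m).trans ?_
    have hS0 : 0 ≤ volume.real S := measureReal_nonneg
    calc (a * m.card + (m.map fun w => Real.posLog ‖w‖).sum) * volume.real S + θ * c * m.card
        ≤ (a * N + K * N) * κ + θ * c * N := by gcongr
      _ = _ := by ring
  -- On `S` the difference is not small, so each potential is bounded separately by uniform
  -- integrability.
  have hSint : ∫ z in S, |u z| ≤ 2 * (((a + K) * κ + θ * c) * N) := by
    have h1 := ((integrableOn_logPot s R).mono_set hSD).abs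
    have h2 := ((integrableOn_logPot t R).mono_set hSD).abs
    calc ∫ z in S, |u z| ≤ ∫ z in S, (|logPot s z| + |logPot t z|) :=
          setIntegral_mono ((hui R).mono_set hSD).abs (h1.add h2) fun z => abs_sub _ _
      _ = (∫ z in S, |logPot s z|) + ∫ z in S, |logPot t z| := integral_add h1 h2
      _ ≤ _ := by
        have := hbd s hs hsK
        have := hbd t ht htK
        linarith
  have hDint : ∫ z in D, |u z| ≤ ε * N * V + 2 * (((a + K) * κ + θ * c) * N) := by
    rw [← integral_inter_add_sdiff hSm (hui R).abs, Set.inter_eq_self_of_subset_right hSD,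
      add_comm]
    refine add_le_add ?_ hSint
    have hfin : volume D ≠ ⊤ := measure_closedBall_lt_top.ne
    calc ∫ z in D \ S, |u z| ≤ ∫ z in D \ S, ε * N := by
          refine setIntegral_mono_on ((hui R).mono_set Set.sdiff_subset).abs
            (integrableOn_const (measure_ne_top_of_subset Set.sdiff_subset hfin))
            (Metric.isClosed_closedBall.measurableSet.diff hSm) fun z hz => ?_
          by_contra h
          exact hz.2 ⟨hz.1, not_le.1 h⟩
      _ = volume.real (D \ S) * (ε * N) := by simp
      _ ≤ V * (ε * N) := by
          gcongr
          exact measureReal_mono Set.sdiff_subset hfin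
      _ = _ := by ring
  have hψint : |∫ z, ψ z * u z| ≤ M * ∫ z in D, |u z| := by
    rw [← integral_const_mul, ← integral_indicator Metric.isClosed_closedBall.measurableSet,
      ← Real.norm_eq_abs]
    refine norm_integral_le_of_norm_le ((integrable_indicator_iff
      Metric.isClosed_closedBall.measurableSet).2 ((hui R).abs.const_mul M))
      (Eventually.of_forall fun z => ?_)
    by_cases hz : z ∈ D
    · rw [Set.indicator_of_mem hz, norm_mul]
      gcongr
      · exact hM z
      · rfl
    · have : ψ z = 0 := by
        by_contra h
        exact hz (hR (subset_tsupport _ h))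
      rw [Set.indicator_of_notMem hz, this]; simp
  set F : ℂ → ℝ := fun w => I⁻¹ * ∫ z, f z * logBump r (z - w) with hF
  have hFsum : ∀ m : Multiset ℂ, (m.map F).sum = I⁻¹ * ∫ z, ψ z * logPot m z := fun m => by
    rw [← sum_map_integral_mul_log hψc hψs, ← Multiset.sum_map_mul_left]
    simp only [hF, integral_mul_logBump hf hfc hr]
  have hFdiff : (s.map F).sum - (t.map F).sum = I⁻¹ * ∫ z, ψ z * u z := by
    rw [hFsum, hFsum, ← mul_sub, ← integral_sub
      (integrable_mul_of_hasCompactSupport hψc hψs fun ρ => integrableOn_logPot s ρ)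
      (integrable_mul_of_hasCompactSupport hψc hψs fun ρ => integrableOn_logPot t ρ)]
    simp_rw [← mul_sub]
    rfl
  have h1 := abs_sum_map_sub_sum_map_le happ s
  have h2 := abs_sum_map_sub_sum_map_le happ t
  have h3 : |(s.map F).sum - (t.map F).sum| ≤ η / 2 * N := by
    rw [hFdiff, abs_mul, abs_of_pos (inv_pos.2 hI0)]
    calc I⁻¹ * |∫ z, ψ z * u z|
        ≤ I⁻¹ * (M * (ε * N * V + 2 * (((a + K) * κ + θ * c) * N))) := by
          gcongr; exact hψint.trans (by gcongr)
      _ = (I⁻¹ * M * V * ε + 2 * (I⁻¹ * M * (a + K) * κ) + 2 * (I⁻¹ * M * c * θ)) * N := by ring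
      _ ≤ (η / 4 + 2 * (η / 16) + 2 * (η / 16)) * N := by gcongr
      _ = _ := by ring
  have h4 : η / 4 * s.card ≤ η / 4 * N := by gcongr
  have h5 : η / 4 * t.card ≤ η / 4 * N := by gcongr
  change |(s.map F).sum - (s.map f).sum| ≤ _ at h1
  change |(t.map F).sum - (t.map f).sum| ≤ _ at h2
  rw [abs_le] at *
  constructor <;> linarith [h1.1, h1.2, h2.1, h2.2, h3.1, h3.2]

/-! ### From compactly supported to bounded test functions -/

/-- The continuous cutoff equal to `1` on the closed disc of radius `T` and to `0` outside the disc
of radius `T + 1`. -/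
def radialCutoff (T : ℝ) (w : ℂ) : ℝ := max 0 (min 1 (T + 1 - ‖w‖))

lemma continuous_radialCutoff (T : ℝ) : Continuous (radialCutoff T) := by
  unfold radialCutoff; fun_prop

lemma hasCompactSupport_radialCutoff (T : ℝ) : HasCompactSupport (radialCutoff T) := by
  refine HasCompactSupport.of_support_subset_isCompact (isCompact_closedBall (0 : ℂ) (T + 1)) ?_
  intro v hv
  by_contra h
  refine hv ?_
  simp only [Metric.mem_closedBall, dist_zero_right, not_le] at h
  exact max_eq_left ((min_le_right _ _).trans (by linarith))

lemma radialCutoff_eq_one {T : ℝ} {w : ℂ} (hw : ‖w‖ ≤ T) : radialCutoff T w = 1 := by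
  unfold radialCutoff
  rw [min_eq_left (by linarith), max_eq_right zero_le_one]

lemma radialCutoff_mem_Icc (T : ℝ) (w : ℂ) : radialCutoff T w ∈ Set.Icc 0 1 :=
  ⟨le_max_left _ _, max_le zero_le_one (min_le_left _ _)⟩

/-- A pointwise Markov bound: wherever the cutoff differs from `1`, `log₊ ‖w‖ ≥ τ`. -/
lemma abs_mul_radialCutoff_sub_le {f : ℂ → ℝ} {B τ : ℝ} (hB : ∀ w, |f w| ≤ B) (hτ : 0 < τ) (w : ℂ) :
    |f w * radialCutoff (Real.exp τ) w - f w| ≤ B / τ * Real.posLog ‖w‖ := by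
  have hB0 : 0 ≤ B := (abs_nonneg _).trans (hB 0)
  have hp := Real.posLog_nonneg (x := ‖w‖)
  by_cases hw : ‖w‖ ≤ Real.exp τ
  · rw [radialCutoff_eq_one hw]; simp; positivity
  · have h1 : τ ≤ Real.posLog ‖w‖ := by
      refine le_trans ?_ (le_max_right _ _)
      exact ((Real.lt_log_iff_exp_lt ((Real.exp_pos τ).trans (not_le.1 hw))).2 (not_le.1 hw)).le
    have hc := radialCutoff_mem_Icc (Real.exp τ) w
    have h2 : |f w * radialCutoff (Real.exp τ) w - f w| ≤ B := by
      rw [← mul_sub_one, abs_mul]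
      calc _ ≤ B * 1 := by
            gcongr
            · exact hB w
            · rw [abs_le]; constructor <;> linarith [hc.1, hc.2]
        _ = B := mul_one B
    refine h2.trans ?_
    rw [div_mul_eq_mul_div, le_div_iff₀ hτ]
    gcongr

/-- Comparison of sums of a bounded continuous function over two multisets with close logarithmic
potentials. -/
lemma exists_abs_sum_sub_sum_le_of_logPot {f : ℂ → ℝ} (hf : Continuous f) {B : ℝ}
    (hB : ∀ w, |f w| ≤ B) {η K : ℝ} (hη : 0 < η) (hK : 0 ≤ K) :
    ∃ R ε κ : ℝ, 0 < ε ∧ 0 < κ ∧ ∀ (N : ℝ) (s t : Multiset ℂ),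
      (s.card : ℝ) ≤ N → (t.card : ℝ) ≤ N →
      (s.map fun w => Real.posLog ‖w‖).sum ≤ K * N →
      (t.map fun w => Real.posLog ‖w‖).sum ≤ K * N →
      volume.real {z ∈ Metric.closedBall (0 : ℂ) R | ε * N < |logPot s z - logPot t z|} ≤ κ →
      |(s.map f).sum - (t.map f).sum| ≤ η * N := by
  have hB0 : 0 ≤ B := (abs_nonneg _).trans (hB 0)
  obtain ⟨x, hx, hx'⟩ := exists_pos_mul_le (A := B * K) (η := η / 4) (by positivity) (by positivity)
  set g : ℂ → ℝ := fun w => f w * radialCutoff (Real.exp x⁻¹) w with hg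
  obtain ⟨R, ε, κ, hε, hκ, H⟩ := exists_abs_sum_sub_sum_le_of_logPot_of_hasCompactSupport
    (f := g) (hf.mul (continuous_radialCutoff _)) (hasCompactSupport_radialCutoff _).mul_left
    (show 0 < η / 2 by positivity) hK
  refine ⟨R, ε, κ, hε, hκ, fun N s t hs ht hsK htK hbad => ?_⟩
  have h0 := H N s t hs ht hsK htK hbad
  have h1 : ∀ m : Multiset ℂ, (m.map fun w => Real.posLog ‖w‖).sum ≤ K * N →
      |(m.map g).sum - (m.map f).sum| ≤ η / 4 * N := fun m hm => by
    have hN : 0 ≤ N := (Nat.cast_nonneg _).trans hs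
    refine (abs_sum_map_sub_sum_map_le_sum
      (abs_mul_radialCutoff_sub_le hB (inv_pos.2 hx)) m).trans ?_
    rw [Multiset.sum_map_mul_left, div_inv_eq_mul]
    calc B * x * (m.map fun w => Real.posLog ‖w‖).sum ≤ B * x * (K * N) := by gcongr
      _ = B * K * x * N := by ring
      _ ≤ η / 4 * N := by gcongr
  have h2 := h1 s hsK
  have h3 := h1 t htK
  rw [abs_le] at *
  constructor <;> linarith [h0.1, h0.2, h2.1, h2.2, h3.1, h3.2]

/-! ### Roots of iterated derivatives -/

lemma natDegree_iterate_derivative_eq (p : ℂ[X]) (ℓ : ℕ) :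
    (derivative^[ℓ] p).natDegree = p.natDegree - ℓ := by
  induction ℓ with
  | zero => simp
  | succ ℓ ih =>
    rw [Function.iterate_succ_apply', natDegree_derivative, ih, Nat.sub_sub]

lemma leadingCoeff_iterate_derivative_of_monic {p : ℂ[X]} (hp : p.Monic) {ℓ : ℕ}
    (hℓ : ℓ ≤ p.natDegree) :
    (derivative^[ℓ] p).leadingCoeff = (p.natDegree.descFactorial ℓ : ℂ) := by
  rw [leadingCoeff, natDegree_iterate_derivative_eq, coeff_iterate_derivative,
    Nat.sub_add_cancel hℓ, hp.coeff_natDegree, nsmul_eq_mul, mul_one]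

lemma one_le_norm_leadingCoeff_iterate_derivative {p : ℂ[X]} (hp : p.Monic) {ℓ : ℕ}
    (hℓ : ℓ ≤ p.natDegree) : 1 ≤ ‖(derivative^[ℓ] p).leadingCoeff‖ := by
  rw [leadingCoeff_iterate_derivative_of_monic hp hℓ, Complex.norm_natCast]
  exact_mod_cast Nat.descFactorial_pos.2 hℓ

lemma norm_leadingCoeff_iterate_derivative_le {p : ℂ[X]} (hp : p.Monic) {ℓ : ℕ}
    (hℓ : ℓ ≤ p.natDegree) : ‖(derivative^[ℓ] p).leadingCoeff‖ ≤ (p.natDegree : ℝ) ^ ℓ := by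
  rw [leadingCoeff_iterate_derivative_of_monic hp hℓ, Complex.norm_natCast]
  exact_mod_cast Nat.descFactorial_le_pow _ _

/-- Each coefficient of `p` is at most a binomial coefficient times the Mahler measure. The
resulting factor `2 ^ p.natDegree` adds only a linear term to the logarithm. -/
lemma mahlerMeasure_iterate_derivative_le (p : ℂ[X]) (ℓ : ℕ) :
    (derivative^[ℓ] p).mahlerMeasure ≤
      (p.natDegree : ℝ) ^ ℓ * 2 ^ p.natDegree * p.mahlerMeasure := by
  have hM := p.mahlerMeasure_nonneg
  refine (mahlerMeasure_le_sum_norm_coeff _).trans ?_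
  rw [sum_over_range _ (by simp), natDegree_iterate_derivative_eq]
  by_cases hℓ : ℓ ≤ p.natDegree
  swap
  · have : derivative^[ℓ] p = 0 := iterate_derivative_eq_zero (not_le.1 hℓ)
    simp only [this, coeff_zero, norm_zero, Finset.sum_const_zero]
    positivity
  calc ∑ i ∈ Finset.range (p.natDegree - ℓ + 1), ‖(derivative^[ℓ] p).coeff i‖
      ≤ ∑ i ∈ Finset.range (p.natDegree - ℓ + 1),
          (p.natDegree : ℝ) ^ ℓ * ((p.natDegree.choose (ℓ + i) : ℝ) * p.mahlerMeasure) := by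
        refine Finset.sum_le_sum fun i hi => ?_
        rw [coeff_iterate_derivative, nsmul_eq_mul, norm_mul, Complex.norm_natCast, add_comm i]
        have hi' : ℓ + i ≤ p.natDegree := by
          have := Finset.mem_range.1 hi; omega
        gcongr
        · calc ((ℓ + i).descFactorial ℓ : ℝ) ≤ ((ℓ + i : ℕ) : ℝ) ^ ℓ := by
                exact_mod_cast Nat.descFactorial_le_pow _ _
            _ ≤ _ := by gcongr
        · exact norm_coeff_le_choose_mul_mahlerMeasure _ _
    _ = (p.natDegree : ℝ) ^ ℓ * (∑ i ∈ Finset.range (p.natDegree - ℓ + 1),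
          (p.natDegree.choose (ℓ + i) : ℝ)) * p.mahlerMeasure := by
        rw [← Finset.mul_sum, ← Finset.sum_mul, mul_assoc]
    _ ≤ _ := by
        gcongr
        have h := Nat.sum_range_choose p.natDegree
        have h2 : ∑ i ∈ Finset.range (p.natDegree - ℓ + 1), p.natDegree.choose (ℓ + i)
            ≤ ∑ i ∈ Finset.range (p.natDegree + 1), p.natDegree.choose i := by
          have : p.natDegree + 1 = ℓ + (p.natDegree - ℓ + 1) := by omega
          rw [this, Finset.sum_range_add (fun i => p.natDegree.choose i)]
          exact Nat.le_add_left _ _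
        exact_mod_cast h ▸ h2

/-- By Jensen, the log Mahler measure is the log of the leading coefficient plus the sum of `log₊`
over the roots. For the derivative the first term is nonnegative and can be dropped. -/
lemma sum_posLog_roots_iterate_derivative_le {p : ℂ[X]} (hp : p.Monic) {ℓ : ℕ}
    (hℓ : ℓ ≤ p.natDegree) :
    ((derivative^[ℓ] p).roots.map fun w => Real.posLog ‖w‖).sum ≤
      ℓ * Real.log p.natDegree + p.natDegree * Real.log 2
        + (p.roots.map fun w => Real.posLog ‖w‖).sum := by
  have h1 := logMahlerMeasure_eq_log_leadingCoeff_add_sum_log_roots p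
  have h2 := logMahlerMeasure_eq_log_leadingCoeff_add_sum_log_roots (derivative^[ℓ] p)
  have h3 := mahlerMeasure_iterate_derivative_le p ℓ
  have hl := one_le_norm_leadingCoeff_iterate_derivative hp hℓ
  rw [hp.leadingCoeff] at h1
  rcases Nat.eq_zero_or_pos p.natDegree with h0 | h0
  · obtain rfl : ℓ = 0 := by omega
    simp [h0]
  have hp0 := mahlerMeasure_pos_of_ne_zero hp.ne_zero
  have hq0 : 0 < (derivative^[ℓ] p).mahlerMeasure :=
    mahlerMeasure_pos_of_ne_zero (by rintro h; rw [h] at hl; simp at hl; linarith)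
  have h4 := Real.log_le_log hq0 h3
  have hN : (p.natDegree : ℝ) ≠ 0 := by positivity
  rw [Real.log_mul (by positivity) hp0.ne', Real.log_mul (by positivity) (by positivity),
    Real.log_pow, Real.log_pow, ← logMahlerMeasure_eq_log_MahlerMeasure,
    ← logMahlerMeasure_eq_log_MahlerMeasure, h1, h2] at h4
  have h5 := Real.log_nonneg hl
  simp at h4
  linarith

lemma iterate_derivative_X_sub_C_mul (a : ℂ) (q : ℂ[X]) (ℓ : ℕ) :
    derivative^[ℓ + 1] ((X - C a) * q) =
      (X - C a) * derivative^[ℓ + 1] q + (ℓ + 1 : ℂ[X]) * derivative^[ℓ] q := by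
  induction ℓ with
  | zero => simp [derivative_mul]; ring
  | succ ℓ ih =>
    rw [Function.iterate_succ_apply', ih]
    simp only [derivative_add, derivative_mul, ← Function.iterate_succ_apply']
    simp
    ring

/-- The quotient of the derivative by the polynomial is `ℓ!` times the `ℓ`-th elementary symmetric
function of the `(z - w)⁻¹`. -/
lemma norm_eval_iterate_derivative_le {z : ℂ} {s : Multiset ℂ} (hz : z ∉ s) (ℓ : ℕ) :
    ‖(derivative^[ℓ] (s.map fun w => X - C w).prod).eval z‖ ≤
      (s.map fun w => ‖z - w‖⁻¹).sum ^ ℓ * ‖(s.map fun w => X - C w).prod.eval z‖ := by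
  induction s using Multiset.induction generalizing ℓ with
  | empty =>
    cases ℓ with
    | zero => simp
    | succ ℓ => simp [Function.iterate_succ_apply]
  | cons a s ih =>
    rw [Multiset.mem_cons, not_or] at hz
    cases ℓ with
    | zero => simp
    | succ ℓ =>
      set q := (s.map fun w => X - C w).prod with hq
      set S := (s.map fun w => ‖z - w‖⁻¹).sum with hS
      have hS0 : 0 ≤ S := Multiset.sum_nonneg fun x hx => by
        obtain ⟨w, -, rfl⟩ := Multiset.mem_map.1 hx
        positivity
      have hza : 0 < ‖z - a‖ := norm_pos_iff.2 (sub_ne_zero.2 hz.1)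
      simp only [Multiset.map_cons, Multiset.prod_cons, Multiset.sum_cons, ← hq, ← hS]
      rw [iterate_derivative_X_sub_C_mul]
      have hc : ((ℓ : ℂ[X]) + 1).eval z = (ℓ : ℂ) + 1 := by simp
      rw [eval_add, eval_mul, eval_mul, eval_mul, hc, eval_sub, eval_X, eval_C, norm_mul]
      have hc' : ‖(ℓ : ℂ) + 1‖ = ℓ + 1 := by
        have := Complex.norm_natCast (ℓ + 1); push_cast at this; exact this
      calc _ ≤ ‖z - a‖ * (S ^ (ℓ + 1) * ‖q.eval z‖) + (ℓ + 1) * (S ^ ℓ * ‖q.eval z‖) := by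
            refine (norm_add_le _ _).trans ?_
            rw [norm_mul, norm_mul, hc']
            gcongr
            · exact ih hz.2 _
            · exact ih hz.2 _
        _ = (S ^ (ℓ + 1) + (ℓ + 1) * ‖z - a‖⁻¹ * S ^ ℓ) * (‖z - a‖ * ‖q.eval z‖) := by
            field_simp
        _ ≤ _ := by
            rw [add_comm ‖z - a‖⁻¹]
            gcongr
            have hb : 0 ≤ ‖z - a‖⁻¹ := by positivity
            -- Bernoulli's inequality: the first two binomial terms of `(S + ‖z - a‖⁻¹) ^ (ℓ + 1)`.
            have := pow_add_mul_le_add_pow hS0 (by positivity : 0 ≤ 2 * S + ‖z - a‖⁻¹) (ℓ + 1)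
            push_cast [Nat.add_sub_cancel] at this
            linarith

lemma log_norm_eval_eq_logPot {p : ℂ[X]} {z : ℂ} (hz : p.eval z ≠ 0) :
    Real.log ‖p.eval z‖ = Real.log ‖p.leadingCoeff‖ + logPot p.roots z := by
  have hp : p ≠ 0 := by rintro rfl; simp at hz
  have key : ∀ s : Multiset ℂ, z ∉ s →
      Real.log ‖(s.map fun w => X - C w).prod.eval z‖ = logPot s z := by
    intro s
    induction s using Multiset.induction with
    | empty => simp
    | cons a s ih =>
      intro h
      rw [Multiset.mem_cons, not_or] at h
      have h2 : (s.map fun w => X - C w).prod.eval z ≠ 0 := by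
        rw [eval_multiset_prod, Multiset.map_map]
        refine Multiset.prod_ne_zero ?_
        simpa [sub_eq_zero] using h.2
      simp only [Multiset.map_cons, Multiset.prod_cons, eval_mul, norm_mul, logPot_cons]
      rw [Real.log_mul (by simpa [sub_eq_zero] using h.1) (by simpa using h2), ih h.2]
      simp
  have hzr : z ∉ p.roots := by rw [mem_roots hp]; exact hz
  rw [← key _ hzr]
  conv_lhs => rw [(IsAlgClosed.splits p).eq_prod_roots]
  have h2 : (p.roots.map fun w => X - C w).prod.eval z ≠ 0 := by
    intro h
    apply hz
    rw [(IsAlgClosed.splits p).eq_prod_roots, eval_mul, h, mul_zero]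
  rw [eval_mul, eval_C, norm_mul, Real.log_mul (by simpa using hp) (by simpa using h2)]

/-! ### Anti-concentration for polynomials with random roots -/

/-- The polynomial `q` with the additional roots `x 0, …, x (k - 1)`. -/
def addRoots (q : ℂ[X]) {k : ℕ} (x : Fin k → ℂ) : ℂ[X] := q * ∏ j, (X - C (x j))

lemma addRoots_succ (q : ℂ[X]) {k : ℕ} (x : Fin (k + 1) → ℂ) :
    addRoots q x = (X - C (x 0)) * addRoots q (Fin.tail x) := by
  simp only [addRoots, Fin.prod_univ_succ, Fin.tail]
  ring

lemma eval_iterate_derivative_X_sub_C_mul (a : ℂ) (q : ℂ[X]) (ℓ : ℕ) (z : ℂ) :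
    (derivative^[ℓ + 1] ((X - C a) * q)).eval z =
      (z - a) * (derivative^[ℓ + 1] q).eval z + (ℓ + 1) * (derivative^[ℓ] q).eval z := by
  rw [iterate_derivative_X_sub_C_mul]
  simp

lemma continuous_eval_iterate_derivative_addRoots (q : ℂ[X]) (k ℓ : ℕ) :
    Continuous fun p : (Fin k → ℂ) × ℂ => (derivative^[ℓ] (addRoots q p.1)).eval p.2 := by
  induction k generalizing ℓ with
  | zero =>
    simp only [addRoots, Finset.univ_eq_empty, Finset.prod_empty, mul_one]
    exact (Polynomial.continuous _).comp continuous_snd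
  | succ k ih =>
    have ht : Continuous fun p : (Fin (k + 1) → ℂ) × ℂ => (Fin.tail p.1, p.2) := by
      unfold Fin.tail; fun_prop
    simp only [addRoots_succ]
    cases ℓ with
    | zero =>
      have := (ih 0).comp ht
      simp only [Function.iterate_zero, id_eq, eval_mul, eval_sub, eval_X, eval_C,
        Function.comp_def] at this ⊢
      fun_prop
    | succ ℓ =>
      have h1 := (ih (ℓ + 1)).comp ht
      have h2 := (ih ℓ).comp ht
      simp only [eval_iterate_derivative_X_sub_C_mul, Function.comp_def] at h1 h2 ⊢
      fun_prop

/-- If `‖a‖ ≥ δ' * Q / (2 * M)`, small values occur only near the zero `z + b / a`. Otherwise `b` is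
the large coefficient and dominates, since `‖z - x‖ ≤ M`, and the set is empty. -/
lemma setOf_norm_affine_lt_subset_ball {z a b : ℂ} {K M Q δ δ' ρ : ℝ} (hQ : 0 < Q) (hM : 1 ≤ M)
    (hz : ‖z‖ + K ≤ M) (hδ' : 0 < δ') (hρ : 0 < ρ) (hδ : δ ≤ δ' / 2) (hδρ : δ ≤ ρ * δ' / (2 * M))
    (hab : δ' * Q ≤ ‖a‖ ∨ δ' * Q ≤ ‖b‖) :
    ∃ c, {x : ℂ | ‖x‖ ≤ K ∧ ‖(z - x) * a + b‖ < δ * Q} ⊆ Metric.ball c ρ := by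
  have hM0 : 0 < M := by linarith
  by_cases ha : δ' * Q ≤ 2 * M * ‖a‖
  · have ha0 : 0 < ‖a‖ := by
      have : 0 < δ' * Q := by positivity
      by_contra h
      have : ‖a‖ = 0 := le_antisymm (not_lt.1 h) (norm_nonneg _)
      rw [this] at ha; linarith
    have ha1 : a ≠ 0 := norm_pos_iff.1 ha0
    refine ⟨z + b / a, fun x hx => ?_⟩
    have h1 : (z - x) * a + b = -(x - (z + b / a)) * a := by field_simp; ring
    have h2 := hx.2
    rw [h1, norm_mul, norm_neg] at h2
    rw [Metric.mem_ball, dist_eq_norm]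
    rw [← mul_lt_mul_iff_of_pos_right ha0]
    refine h2.trans_le ?_
    calc δ * Q ≤ ρ * δ' / (2 * M) * Q := by gcongr
      _ = ρ * (δ' * Q / (2 * M)) := by ring
      _ ≤ ρ * ‖a‖ := by
        gcongr
        rw [div_le_iff₀ (by positivity)]; linarith
  · refine ⟨0, fun x hx => ?_⟩
    exfalso
    have hx1 := hx.1
    have hx2 := hx.2
    rcases hab with h | h
    · apply ha
      nlinarith [norm_nonneg a]
    · have h1 : ‖z - x‖ ≤ M := (norm_sub_le _ _).trans (by linarith)
      have h2 : ‖b‖ ≤ ‖(z - x) * a + b‖ + ‖z - x‖ * ‖a‖ := by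
        rw [← norm_mul]
        simpa using norm_sub_le ((z - x) * a + b) ((z - x) * a)
      have h3 : ‖z - x‖ * ‖a‖ ≤ M * ‖a‖ := by gcongr
      have h4 : δ * Q ≤ δ' / 2 * Q := by gcongr
      linarith

/-- Either both coefficients are small, which costs `η`, or Fubini applies with a disc of radius `ρ`
in the first variable. `T` may be non-measurable, as it does not enter `G`. -/
lemma prod_measure_norm_affine_lt_le {Y : Type*} [MeasurableSpace Y] {ν₀ : Measure ℂ}
    {ν' : Measure Y} [IsProbabilityMeasure ν₀] [IsProbabilityMeasure ν'] {A : ENNReal}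
    (hA : ∀ S, ν₀ S ≤ A * volume S) {a b : Y → ℂ} (ha : Measurable a) (hb : Measurable b)
    (T : Set Y) {η : ENNReal} {z : ℂ} {K M Q δ δ' ρ : ℝ} (hQ : 0 < Q) (hM : 1 ≤ M)
    (hz : ‖z‖ + K ≤ M) (hδ' : 0 < δ') (hρ : 0 < ρ) (hδ : δ ≤ δ' / 2) (hδρ : δ ≤ ρ * δ' / (2 * M))
    (hT : ν' {y | y ∈ T ∧ ‖a y‖ < δ' * Q ∧ ‖b y‖ < δ' * Q} ≤ η) :
    (ν₀.prod ν') {p | ‖p.1‖ ≤ K ∧ p.2 ∈ T ∧ ‖(z - p.1) * a p.2 + b p.2‖ < δ * Q} ≤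
      η + A * volume (Metric.ball (0 : ℂ) ρ) := by
  set G : Set (ℂ × Y) := {p | (δ' * Q ≤ ‖a p.2‖ ∨ δ' * Q ≤ ‖b p.2‖) ∧ ‖p.1‖ ≤ K ∧
    ‖(z - p.1) * a p.2 + b p.2‖ < δ * Q} with hG
  have hGm : MeasurableSet G := by
    have h1 : MeasurableSet {p : ℂ × Y | δ' * Q ≤ ‖a p.2‖} :=
      measurableSet_le (by fun_prop) (by fun_prop)
    have h2 : MeasurableSet {p : ℂ × Y | δ' * Q ≤ ‖b p.2‖} :=
      measurableSet_le (by fun_prop) (by fun_prop)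
    have h3 : MeasurableSet {p : ℂ × Y | ‖p.1‖ ≤ K} :=
      measurableSet_le (by fun_prop) (by fun_prop)
    have h4 : MeasurableSet {p : ℂ × Y | ‖(z - p.1) * a p.2 + b p.2‖ < δ * Q} :=
      measurableSet_lt (by fun_prop) (by fun_prop)
    exact (h1.union h2).inter (h3.inter h4)
  have hsub : {p : ℂ × Y | ‖p.1‖ ≤ K ∧ p.2 ∈ T ∧ ‖(z - p.1) * a p.2 + b p.2‖ < δ * Q} ⊆
      Set.univ ×ˢ {y | y ∈ T ∧ ‖a y‖ < δ' * Q ∧ ‖b y‖ < δ' * Q} ∪ G := by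
    rintro p ⟨h1, h2, h3⟩
    by_cases h : ‖a p.2‖ < δ' * Q ∧ ‖b p.2‖ < δ' * Q
    · exact Or.inl ⟨Set.mem_univ _, h2, h⟩
    · rw [not_and_or, not_lt, not_lt] at h
      exact Or.inr ⟨h, h1, h3⟩
  refine (measure_mono hsub).trans ((measure_union_le _ _).trans (add_le_add ?_ ?_))
  · rw [Measure.prod_prod, measure_univ, one_mul]; exact hT
  · rw [Measure.prod_apply_symm hGm]
    calc ∫⁻ y, ν₀ ((fun x => (x, y)) ⁻¹' G) ∂ν'
        ≤ ∫⁻ _, A * volume (Metric.ball (0 : ℂ) ρ) ∂ν' := by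
          refine lintegral_mono fun y => ?_
          by_cases hab : δ' * Q ≤ ‖a y‖ ∨ δ' * Q ≤ ‖b y‖
          · obtain ⟨c, hc⟩ := setOf_norm_affine_lt_subset_ball hQ hM hz hδ' hρ hδ hδρ hab
            calc ν₀ ((fun x => (x, y)) ⁻¹' G) ≤ ν₀ (Metric.ball c ρ) :=
                  measure_mono fun x hx => hc hx.2
              _ ≤ A * volume (Metric.ball c ρ) := hA _
              _ = _ := by rw [Measure.addHaar_ball_center]
          · have : (fun x => (x, y)) ⁻¹' G = ∅ := by
              ext x; simp only [Set.mem_empty_iff_false, iff_false]; exact fun hx => hab hx.1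
            rw [this]; simp
      _ = _ := by simp

lemma exists_mul_volume_ball_le {A η : ENNReal} (hA : A ≠ ⊤) (hη : η ≠ 0) :
    ∃ ρ : ℝ, 0 < ρ ∧ A * volume (Metric.ball (0 : ℂ) ρ) ≤ η := by
  have h : Tendsto (fun ρ : ℝ => A * volume (Metric.ball (0 : ℂ) ρ)) (𝓝[>] 0) (𝓝 0) := by
    have h1 : Tendsto (fun ρ : ℝ => A * (ENNReal.ofReal ρ ^ 2 * NNReal.pi)) (𝓝 0) (𝓝 0) := by
      have h0 : Tendsto (fun ρ : ℝ => ENNReal.ofReal ρ) (𝓝 0) (𝓝 0) := by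
        simpa using (ENNReal.continuous_ofReal.tendsto 0)
      have h2 : Tendsto (fun ρ : ℝ => ENNReal.ofReal ρ ^ 2) (𝓝 0) (𝓝 0) := by
        simpa using ENNReal.Tendsto.pow (n := 2) h0
      have h3 := ENNReal.Tendsto.mul_const (b := (NNReal.pi : ENNReal)) h2 (Or.inr (by simp))
      have h4 := ENNReal.Tendsto.const_mul (a := A) h3 (Or.inr hA)
      simpa using h4
    refine (h1.mono_left nhdsWithin_le_nhds).congr fun ρ => ?_
    rw [Complex.volume_ball]
  have h2 := (h.eventually_le_const (pos_iff_ne_zero.2 hη)).and self_mem_nhdsWithin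
  obtain ⟨ρ, h1, h2⟩ := h2.exists
  exact ⟨ρ, h2, h1⟩

/-- Induction on the number of random roots, freezing all but the first. It matters that `δ` depends
on neither `z` nor `q`. -/
lemma exists_pi_measure_eval_iterate_derivative_lt_le {k : ℕ} (ν : Fin k → Measure ℂ)
    [∀ j, IsProbabilityMeasure (ν j)] {A : ENNReal} (hA : A ≠ ⊤)
    (hν : ∀ j S, ν j S ≤ A * volume S) {ℓ : ℕ} (hℓ : ℓ ≤ k) (K R : ℝ)
    {η : ENNReal} (hη : η ≠ 0) :
    ∃ δ : ℝ, 0 < δ ∧ ∀ z ∈ Metric.closedBall (0 : ℂ) R, ∀ q : ℂ[X], q.eval z ≠ 0 →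
      Measure.pi ν {x | (∀ j, ‖x j‖ ≤ K) ∧
        ‖(derivative^[ℓ] (addRoots q x)).eval z‖ < δ * ‖q.eval z‖} ≤ η := by
  induction k generalizing ℓ η with
  | zero =>
    obtain rfl : ℓ = 0 := by omega
    refine ⟨1, one_pos, fun z _ q _ => ?_⟩
    simp [addRoots]
  | succ k ih =>
    have hη2 : η / 2 ≠ 0 := by simpa using hη
    obtain ⟨δ', hδ', H⟩ := ih (fun j => ν j.succ) (fun j => hν j.succ)
      (show ℓ - 1 ≤ k by omega) hη2
    obtain ⟨ρ, hρ, hρη⟩ := exists_mul_volume_ball_le hA hη2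
    set M := max 1 (R + K) with hM
    have hM1 : 1 ≤ M := le_max_left _ _
    have hM0 : 0 < M := by linarith
    refine ⟨min (δ' / 2) (ρ * δ' / (2 * M)), by positivity, fun z hz q hq => ?_⟩
    set δ := min (δ' / 2) (ρ * δ' / (2 * M)) with hδ
    have hQ : 0 < ‖q.eval z‖ := norm_pos_iff.2 hq
    have hzM : ‖z‖ + K ≤ M := by
      have : ‖z‖ ≤ R := by simpa using hz
      exact le_trans (by linarith) (le_max_right _ _)
    have hc : ∀ i, Measurable fun y : Fin k → ℂ => (derivative^[i] (addRoots q y)).eval z :=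
      fun i => ((continuous_eval_iterate_derivative_addRoots q k i).comp
        (continuous_id.prodMk continuous_const)).measurable
    have hmp := measurePreserving_piFinSuccAbove ν 0
    -- For `ℓ > 0` the hypothesis at order `ℓ - 1` controls `b`, a multiple of the derivative of
    -- that order. For `ℓ = 0` the truncated `ℓ - 1` is `0`, and it controls `a`, with `b = 0`.
    obtain ⟨a, b, ha, hb, hab, heq⟩ : ∃ a b : (Fin k → ℂ) → ℂ, Measurable a ∧ Measurable b ∧
        (∀ y, ‖a y‖ < δ' * ‖q.eval z‖ ∧ ‖b y‖ < δ' * ‖q.eval z‖ →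
          ‖(derivative^[ℓ - 1] (addRoots q y)).eval z‖ < δ' * ‖q.eval z‖) ∧
        ∀ x : Fin (k + 1) → ℂ, (derivative^[ℓ] (addRoots q x)).eval z =
          (z - x 0) * a (Fin.tail x) + b (Fin.tail x) := by
      cases ℓ with
      | zero =>
        refine ⟨_, fun _ => 0, hc 0, measurable_const, fun y hy => hy.1, fun x => ?_⟩
        rw [addRoots_succ]; simp
      | succ ℓ =>
        refine ⟨_, fun y => (ℓ + 1) * (derivative^[ℓ] (addRoots q y)).eval z, hc (ℓ + 1),
          (hc ℓ).const_mul _, fun y hy => ?_, fun x => ?_⟩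
        · refine lt_of_le_of_lt ?_ hy.2
          rw [norm_mul]
          have : ‖(ℓ : ℂ) + 1‖ = ℓ + 1 := by
            have := Complex.norm_natCast (ℓ + 1); push_cast at this; exact this
          rw [this, Nat.add_sub_cancel]
          exact le_mul_of_one_le_left (norm_nonneg _) (by simp)
        · rw [addRoots_succ, eval_iterate_derivative_X_sub_C_mul]
    have hset : {x : Fin (k + 1) → ℂ | (∀ j, ‖x j‖ ≤ K) ∧
        ‖(derivative^[ℓ] (addRoots q x)).eval z‖ < δ * ‖q.eval z‖} =
        MeasurableEquiv.piFinSuccAbove (fun _ => ℂ) 0 ⁻¹' {p | ‖p.1‖ ≤ K ∧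
          p.2 ∈ {y : Fin k → ℂ | ∀ j, ‖y j‖ ≤ K} ∧
          ‖(z - p.1) * a p.2 + b p.2‖ < δ * ‖q.eval z‖} := by
      ext x
      simp only [Set.mem_ofPred_eq, Set.mem_preimage, heq, Fin.forall_fin_succ, and_assoc]
      rfl
    rw [hset, hmp.measure_preimage_equiv]
    have hsub : {y : Fin k → ℂ | y ∈ {y : Fin k → ℂ | ∀ j, ‖y j‖ ≤ K} ∧
        ‖a y‖ < δ' * ‖q.eval z‖ ∧ ‖b y‖ < δ' * ‖q.eval z‖} ⊆ {y | (∀ j, ‖y j‖ ≤ K) ∧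
        ‖(derivative^[ℓ - 1] (addRoots q y)).eval z‖ < δ' * ‖q.eval z‖} :=
      fun y hy => ⟨hy.1, hab y hy.2⟩
    have := prod_measure_norm_affine_lt_le (ν₀ := ν 0)
      (ν' := Measure.pi fun j => ν (Fin.succAbove 0 j)) (hν 0) ha hb
      {y : Fin k → ℂ | ∀ j, ‖y j‖ ≤ K} (η := η / 2) hQ hM1 hzM hδ' hρ (min_le_left _ _)
      (min_le_right _ _) ((measure_mono hsub).trans (H z hz q hq))
    refine this.trans ((add_le_add le_rfl hρη).trans ?_)
    rw [ENNReal.add_halves]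

/-- For a polynomial with random extra roots, a derivative of not too high order is rarely small on
a substantial part of a disc. -/
lemma exists_pi_measure_volume_le {k : ℕ} (ν : Fin k → Measure ℂ)
    [∀ j, IsProbabilityMeasure (ν j)] {A : ENNReal} (hA : A ≠ ⊤)
    (hν : ∀ j S, ν j S ≤ A * volume S) {ℓ : ℕ} (hℓ : ℓ ≤ k) (K R : ℝ)
    {η κ : ENNReal} (hη : η ≠ 0) (hκ : κ ≠ 0) (hκ' : κ ≠ ⊤) :
    ∃ δ : ℝ, 0 < δ ∧ ∀ q : ℂ[X], q ≠ 0 →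
      Measure.pi ν {x | (∀ j, ‖x j‖ ≤ K) ∧ κ ≤ volume {z ∈ Metric.closedBall (0 : ℂ) R |
        ‖(derivative^[ℓ] (addRoots q x)).eval z‖ < δ * ‖q.eval z‖}} ≤ η := by
  set D := Metric.closedBall (0 : ℂ) R with hD
  have hDm : MeasurableSet D := Metric.isClosed_closedBall.measurableSet
  -- The expected bad area is at most `η' * volume D < κ * η`, so Markov at level `κ` yields `η`.
  obtain ⟨η', hη', hlt⟩ := ENNReal.exists_nnreal_pos_mul_lt (a := volume D) (b := κ * η)
    measure_closedBall_lt_top.ne (mul_ne_zero hκ hη)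
  obtain ⟨δ, hδ, H⟩ := exists_pi_measure_eval_iterate_derivative_lt_le ν hA hν hℓ K R
    (η := η') (by exact_mod_cast hη'.ne')
  refine ⟨δ, hδ, fun q hq => ?_⟩
  set W : Set ((Fin k → ℂ) × ℂ) := {p | ((∀ j, ‖p.1 j‖ ≤ K) ∧ p.2 ∈ D) ∧
    ‖(derivative^[ℓ] (addRoots q p.1)).eval p.2‖ < δ * ‖q.eval p.2‖} with hW
  have hWm : MeasurableSet W := by
    refine MeasurableSet.inter (MeasurableSet.inter ?_ (measurable_snd hDm)) ?_
    · have : {p : (Fin k → ℂ) × ℂ | ∀ j, ‖p.1 j‖ ≤ K} = ⋂ j, {p | ‖p.1 j‖ ≤ K} := by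
        ext; simp
      change MeasurableSet {p : (Fin k → ℂ) × ℂ | ∀ j, ‖p.1 j‖ ≤ K}
      rw [this]
      exact MeasurableSet.iInter fun j => measurableSet_le (by fun_prop) (by fun_prop)
    · have h1 := (continuous_eval_iterate_derivative_addRoots q k ℓ).measurable
      have h2 : Measurable fun p : (Fin k → ℂ) × ℂ => q.eval p.2 :=
        q.continuous.measurable.comp measurable_snd
      exact measurableSet_lt h1.norm (h2.norm.const_mul δ)
  have hroots : ∀ᵐ z : ℂ, q.eval z ≠ 0 := by
    have : {z : ℂ | ¬ q.eval z ≠ 0} ⊆ (q.roots.toFinset : Set ℂ) := fun z hz => by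
      simpa [hq] using hz
    exact measure_mono_null this (Finset.measure_zero _ _)
  have hWle : ((Measure.pi ν).prod volume) W ≤ η' * volume D := by
    rw [Measure.prod_apply_symm hWm, ← setLIntegral_const, ← lintegral_indicator hDm]
    refine lintegral_mono_ae ?_
    filter_upwards [hroots] with z hz
    by_cases hzD : z ∈ D
    · rw [Set.indicator_of_mem hzD]
      have hsub : (fun x => (x, z)) ⁻¹' W ⊆ {x | (∀ j, ‖x j‖ ≤ K) ∧
          ‖(derivative^[ℓ] (addRoots q x)).eval z‖ < δ * ‖q.eval z‖} :=
        fun x hx => ⟨hx.1.1, hx.2⟩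
      exact (measure_mono hsub).trans (H z hzD q hz)
    · have : (fun x => (x, z)) ⁻¹' W = ∅ := by
        ext x; simp only [Set.mem_empty_iff_false, iff_false]; exact fun hx => hzD hx.1.2
      rw [this]; simp
  rw [Measure.prod_apply hWm] at hWle
  have hmk := mul_meas_ge_le_lintegral (μ := Measure.pi ν)
    (measurable_measure_prodMk_left (ν := (volume : Measure ℂ)) hWm) κ
  have hsub : {x : Fin k → ℂ | (∀ j, ‖x j‖ ≤ K) ∧ κ ≤ volume {z ∈ D |
        ‖(derivative^[ℓ] (addRoots q x)).eval z‖ < δ * ‖q.eval z‖}} ⊆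
      {x | κ ≤ volume (Prod.mk x ⁻¹' W)} := by
    rintro x ⟨hx1, hx2⟩
    refine hx2.trans (measure_mono fun z hz => ⟨⟨hx1, hz.1⟩, hz.2⟩)
  rw [← ENNReal.mul_le_mul_iff_right hκ hκ']
  calc _ ≤ κ * Measure.pi ν {x | κ ≤ volume (Prod.mk x ⁻¹' W)} := by gcongr
    _ ≤ _ := hmk.trans (hWle.trans hlt.le)

/-! ### Comparison of the zeros of a polynomial and of its derivatives -/

lemma integrableOn_sum_norm_sub_inv (s : Multiset ℂ) (R : ℝ) :
    IntegrableOn (fun z => (s.map fun w => ‖z - w‖⁻¹).sum) (Metric.closedBall 0 R) := by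
  induction s using Multiset.induction with
  | empty => simp
  | cons a s ih =>
    simp only [Multiset.map_cons, Multiset.sum_cons]
    exact (integrableOn_norm_sub_inv R a).add ih

lemma setIntegral_sum_norm_sub_inv_le {R c : ℝ}
    (hc : ∀ w : ℂ, ∫ z in Metric.closedBall (0 : ℂ) R, ‖z - w‖⁻¹ ≤ c) (s : Multiset ℂ) :
    ∫ z in Metric.closedBall (0 : ℂ) R, (s.map fun w => ‖z - w‖⁻¹).sum ≤ s.card * c := by
  induction s using Multiset.induction with
  | empty => simp
  | cons a s ih =>
    simp only [Multiset.map_cons, Multiset.sum_cons, Multiset.card_cons]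
    rw [integral_add (integrableOn_norm_sub_inv R a) (integrableOn_sum_norm_sub_inv s R)]
    push_cast
    linarith [hc a]

lemma sum_norm_sub_inv_nonneg (s : Multiset ℂ) (z : ℂ) : 0 ≤ (s.map fun w => ‖z - w‖⁻¹).sum :=
  Multiset.sum_nonneg fun x hx => by
    obtain ⟨w, -, rfl⟩ := Multiset.mem_map.1 hx
    positivity

lemma mul_volume_sum_norm_sub_inv_ge_le {R c : ℝ}
    (hc : ∀ w : ℂ, ∫ z in Metric.closedBall (0 : ℂ) R, ‖z - w‖⁻¹ ≤ c) (s : Multiset ℂ) (Λ : ℝ) :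
    Λ * volume.real {z ∈ Metric.closedBall (0 : ℂ) R | Λ ≤ (s.map fun w => ‖z - w‖⁻¹).sum} ≤
      s.card * c := by
  have h := mul_meas_ge_le_integral_of_nonneg (μ := volume.restrict (Metric.closedBall (0 : ℂ) R))
    (Eventually.of_forall (sum_norm_sub_inv_nonneg s)) (integrableOn_sum_norm_sub_inv s R) Λ
  rw [measureReal_restrict_apply' Metric.isClosed_closedBall.measurableSet, Set.inter_comm] at h
  exact h.trans (setIntegral_sum_norm_sub_inv_le hc s)

lemma monic_addRoots {q : ℂ[X]} (hq : q.Monic) {k : ℕ} (x : Fin k → ℂ) : (addRoots q x).Monic :=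
  hq.mul (monic_prod_X_sub_C _ _)

lemma natDegree_addRoots {q : ℂ[X]} (hq : q.Monic) {k : ℕ} (x : Fin k → ℂ) :
    (addRoots q x).natDegree = q.natDegree + k := by
  rw [addRoots, hq.natDegree_mul (monic_prod_X_sub_C _ _),
    natDegree_finsetProd_X_sub_C_eq_card]
  simp

lemma roots_addRoots {q : ℂ[X]} (hq : q.Monic) {k : ℕ} (x : Fin k → ℂ) :
    (addRoots q x).roots = q.roots + Finset.univ.val.map x := by
  rw [addRoots, roots_mul (monic_addRoots hq x).ne_zero]
  congr 1
  exact roots_multiset_prod_X_sub_C (Finset.univ.val.map x) ▸ by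
    rw [Multiset.map_map]; rfl

lemma norm_eval_addRoots_le (q : ℂ[X]) {k : ℕ} {x : Fin k → ℂ} {K R : ℝ} (hx : ∀ j, ‖x j‖ ≤ K)
    {z : ℂ} (hz : ‖z‖ ≤ R) :
    ‖(addRoots q x).eval z‖ ≤ ‖q.eval z‖ * (max 1 (R + K)) ^ k := by
  rw [addRoots, eval_mul, norm_mul, eval_prod, norm_prod]
  gcongr
  calc ∏ j, ‖(X - C (x j)).eval z‖ ≤ ∏ _j : Fin k, max 1 (R + K) := by
        refine Finset.prod_le_prod (fun _ _ => norm_nonneg _) fun j _ => ?_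
        rw [eval_sub, eval_X, eval_C]
        exact (norm_sub_le _ _).trans ((add_le_add hz (hx j)).trans (le_max_right _ _))
    _ = _ := by simp

lemma card_roots_iterate_derivative (p : ℂ[X]) (ℓ : ℕ) :
    (derivative^[ℓ] p).roots.card = p.natDegree - ℓ := by
  rw [← natDegree_iterate_derivative_eq, ← (IsAlgClosed.splits _).natDegree_eq_card_roots]

/-- Off the exceptional sets `log ‖d‖ - log ‖p‖` is squeezed between `log δ - k * log (max 1 (R +
K))` and `2 * ℓ * log N`; the leading coefficient of `d` costs at most `ℓ * log N` more. -/
lemma volume_setOf_logPot_le {q : ℂ[X]} (hq : q.Monic) {k ℓ : ℕ} (hℓ : ℓ ≤ k) {x : Fin k → ℂ}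
    {K R c ε κ δ N : ℝ} (hx : ∀ j, ‖x j‖ ≤ K)
    (hc : ∀ w : ℂ, ∫ z in Metric.closedBall (0 : ℂ) R, ‖z - w‖⁻¹ ≤ c) (hδ : 0 < δ)
    (hN : (q.natDegree + k : ℕ) = N) (hN1 : 1 ≤ N) (h1 : ℓ * (2 * Real.log N) ≤ ε * N)
    (h2 : ℓ * Real.log N + k * Real.log (max 1 (R + K)) - Real.log δ ≤ ε * N)
    (h3 : c ≤ κ / 2 * N)
    (h4 : volume.real {z ∈ Metric.closedBall (0 : ℂ) R |
      ‖(derivative^[ℓ] (addRoots q x)).eval z‖ < δ * ‖q.eval z‖} ≤ κ / 2) :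
    volume.real {z ∈ Metric.closedBall (0 : ℂ) R | ε * N <
      |logPot (derivative^[ℓ] (addRoots q x)).roots z - logPot (addRoots q x).roots z|} ≤ κ := by
  set p := addRoots q x with hp
  have hpm : p.Monic := monic_addRoots hq x
  have hpN : (p.natDegree : ℝ) = N := by rw [hp, natDegree_addRoots hq, hN]
  have hℓp : ℓ ≤ p.natDegree := by rw [hp, natDegree_addRoots hq]; omega
  set D := Metric.closedBall (0 : ℂ) R with hD
  have hDfin : volume D ≠ ⊤ := measure_closedBall_lt_top.ne
  set d := derivative^[ℓ] p with hd
  have hlead1 : 1 ≤ ‖d.leadingCoeff‖ := one_le_norm_leadingCoeff_iterate_derivative hpm hℓp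
  have hlead2 : ‖d.leadingCoeff‖ ≤ N ^ ℓ := hpN ▸ norm_leadingCoeff_iterate_derivative_le hpm hℓp
  have hd0 : d ≠ 0 := by rintro h; rw [h] at hlead1; simp at hlead1; linarith
  set E₁ := {z ∈ D | ‖d.eval z‖ < δ * ‖q.eval z‖} with hE₁
  -- The sum has integral at most `c * N`, so `E₂` has area at most `c / N`.
  set E₂ := {z ∈ D | N ^ 2 ≤ (p.roots.map fun w => ‖z - w‖⁻¹).sum} with hE₂
  set E₃ : Set ℂ := ((p.roots.toFinset ∪ d.roots.toFinset : Finset ℂ) : Set ℂ) with hE₃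
  have hpprod : (p.roots.map fun w => X - C w).prod = p := by
    have := (IsAlgClosed.splits p).eq_prod_roots
    rw [hpm.leadingCoeff, C_1, one_mul] at this
    exact this.symm
  have hsub : {z ∈ D | ε * N < |logPot d.roots z - logPot p.roots z|} ⊆ (E₁ ∪ E₂) ∪ E₃ := by
    rintro z ⟨hzD, hz⟩
    by_contra hcon
    simp only [Set.mem_union, not_or] at hcon
    obtain ⟨⟨hz1, hz2⟩, hz3⟩ := hcon
    have hz1 : δ * ‖q.eval z‖ ≤ ‖d.eval z‖ := not_lt.1 fun h => hz1 ⟨hzD, h⟩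
    have hz2 : (p.roots.map fun w => ‖z - w‖⁻¹).sum ≤ N ^ 2 :=
      (not_le.1 fun h => hz2 ⟨hzD, h⟩).le
    simp only [hE₃, Finset.coe_union, Set.mem_union, Finset.mem_coe, Multiset.mem_toFinset,
      not_or] at hz3
    have hpz : p.eval z ≠ 0 := fun h => hz3.1 ((mem_roots hpm.ne_zero).2 h)
    have hdz : d.eval z ≠ 0 := fun h => hz3.2 ((mem_roots hd0).2 h)
    have hqz : q.eval z ≠ 0 := fun h => hpz (by rw [hp, addRoots, eval_mul, h, zero_mul])
    have e1 := log_norm_eval_eq_logPot hpz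
    have e2 := log_norm_eval_eq_logPot hdz
    rw [hpm.leadingCoeff, norm_one, Real.log_one, zero_add] at e1
    have hl1 := Real.log_nonneg hlead1
    have hl2 := Real.log_le_log (by linarith) hlead2
    rw [Real.log_pow] at hl2
    have hup : Real.log ‖d.eval z‖ ≤ ℓ * (2 * Real.log N) + Real.log ‖p.eval z‖ := by
      have h := norm_eval_iterate_derivative_le hz3.1 ℓ
      rw [hpprod] at h
      have h' : ‖d.eval z‖ ≤ (N ^ 2) ^ ℓ * ‖p.eval z‖ := h.trans (by
        gcongr
        exact sum_norm_sub_inv_nonneg _ _)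
      have h'' := Real.log_le_log (norm_pos_iff.2 hdz) h'
      rw [Real.log_mul (by positivity) (norm_ne_zero_iff.2 hpz), Real.log_pow, Real.log_pow] at h''
      exact_mod_cast h''
    have hlow : Real.log δ + Real.log ‖q.eval z‖ ≤ Real.log ‖d.eval z‖ := by
      rw [← Real.log_mul hδ.ne' (norm_ne_zero_iff.2 hqz)]
      exact Real.log_le_log (mul_pos hδ (norm_pos_iff.2 hqz)) hz1
    have hpq : Real.log ‖p.eval z‖ ≤ Real.log ‖q.eval z‖ + k * Real.log (max 1 (R + K)) := by
      have h := Real.log_le_log (norm_pos_iff.2 hpz)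
        (norm_eval_addRoots_le q hx (by simpa [hD] using hzD))
      have hM : (0 : ℝ) < max 1 (R + K) := lt_of_lt_of_le one_pos (le_max_left _ _)
      rwa [Real.log_mul (norm_ne_zero_iff.2 hqz) (by positivity), Real.log_pow] at h
    refine absurd hz (not_lt.2 ?_)
    rw [abs_le]
    constructor <;> linarith
  have hE₃0 : volume.real E₃ = 0 := by
    rw [measureReal_def, Finset.measure_zero]; rfl
  have hE₁fin : volume (E₁ ∪ E₂) ≠ ⊤ :=
    measure_ne_top_of_subset (Set.union_subset (Set.sep_subset _ _) (Set.sep_subset _ _)) hDfin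
  have hE₂le : volume.real E₂ ≤ κ / 2 := by
    have h := mul_volume_sum_norm_sub_inv_ge_le hc p.roots (N ^ 2)
    have hcard : (p.roots.card : ℝ) = N := by
      rw [← (IsAlgClosed.splits p).natDegree_eq_card_roots, hpN]
    rw [hcard] at h
    have h' : N ^ 2 * volume.real E₂ ≤ N ^ 2 * (κ / 2) := h.trans (by nlinarith)
    exact le_of_mul_le_mul_left h' (by positivity)
  calc _ ≤ volume.real ((E₁ ∪ E₂) ∪ E₃) := by
        refine measureReal_mono hsub ?_
        refine (measure_union_lt_top (lt_top_iff_ne_top.2 hE₁fin) ?_).ne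
        rw [Finset.measure_zero]; exact ENNReal.zero_lt_top
    _ ≤ volume.real (E₁ ∪ E₂) + volume.real E₃ := measureReal_union_le _ _
    _ ≤ volume.real E₁ + volume.real E₂ + volume.real E₃ := by
        gcongr; exact measureReal_union_le _ _
    _ ≤ κ := by rw [hE₃0]; linarith

/-! ### Averages over multisets -/

lemma integral_sum_diracProba (f : BoundedContinuousFunction ℂ ℝ) (s : Multiset ℂ) :
    ∫ w, f w ∂(((s.map fun a => (diracProba a).toFiniteMeasure).sum : FiniteMeasure ℂ) : Measure ℂ)
      = (s.map f).sum := by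
  induction s using Multiset.induction with
  | empty => simp
  | cons a s ih =>
    rw [Multiset.map_cons, Multiset.sum_cons, FiniteMeasure.toMeasure_add, integral_add_measure
      (f.integrable _) (f.integrable _), ih, Multiset.map_cons, Multiset.sum_cons]
    congr 1
    change ∫ w, f w ∂(Measure.dirac a) = f a
    simp

lemma integral_uniformOnMultiset (f : BoundedContinuousFunction ℂ ℝ) (s : Multiset ℂ) :
    ∫ w, f w ∂(uniformOnMultiset s : Measure ℂ) = (s.card : ℝ)⁻¹ * (s.map f).sum := by
  rw [uniformOnMultiset, FiniteMeasure.toMeasure_smul, integral_smul_nnreal_measure,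
    integral_sum_diracProba, NNReal.smul_def, smul_eq_mul]
  simp

lemma abs_sum_map_le {f : ℂ → ℝ} {B : ℝ} (hB : ∀ w, |f w| ≤ B) (s : Multiset ℂ) :
    |(s.map f).sum| ≤ B * s.card := by
  simpa using abs_sum_map_sub_sum_map_le (f := f) (g := fun _ => 0) (by simpa using hB) s

/-- The term `B * k / t.card` pays for the change of normalisation. -/
lemma abs_average_sub_average_le {f : ℂ → ℝ} {B τ : ℝ} (hB : ∀ w, |f w| ≤ B) {s t : Multiset ℂ}
    {k : ℕ} (hts : t.card ≤ s.card) (hst : s.card ≤ t.card + k) (ht : 0 < t.card)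
    (h : |(s.map f).sum - (t.map f).sum| ≤ τ * t.card) :
    |(s.card : ℝ)⁻¹ * (s.map f).sum - (t.card : ℝ)⁻¹ * (t.map f).sum| ≤ τ + B * k / t.card := by
  have hB0 : 0 ≤ B := (abs_nonneg _).trans (hB 0)
  have ht0 : (0 : ℝ) < t.card := by exact_mod_cast ht
  have hs0 : (0 : ℝ) < s.card := by exact_mod_cast ht.trans_le hts
  have h1 : (s.card : ℝ)⁻¹ * (s.map f).sum - (t.card : ℝ)⁻¹ * (t.map f).sum =
      (t.card : ℝ)⁻¹ * ((s.map f).sum - (t.map f).sum)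
        - (t.card : ℝ)⁻¹ * ((s.card : ℝ)⁻¹ * (s.map f).sum * (s.card - t.card)) := by
    field_simp; ring
  have h2 : |(s.card : ℝ)⁻¹ * (s.map f).sum| ≤ B := by
    rw [abs_mul, abs_of_pos (inv_pos.2 hs0), inv_mul_le_iff₀ hs0, mul_comm]
    exact abs_sum_map_le hB s
  have h3 : |(s.card : ℝ) - t.card| ≤ k := by
    have a1 : (t.card : ℝ) ≤ s.card := by exact_mod_cast hts
    have a2 : (s.card : ℝ) ≤ t.card + k := by exact_mod_cast hst
    rw [abs_le]; constructor <;> linarith [(Nat.cast_nonneg k : (0 : ℝ) ≤ k)]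
  rw [h1]
  refine (abs_sub _ _).trans (add_le_add ?_ ?_)
  · rw [abs_mul, abs_of_pos (inv_pos.2 ht0), inv_mul_le_iff₀ ht0]; linarith
  · rw [abs_mul, abs_of_pos (inv_pos.2 ht0), inv_mul_eq_div]
    gcongr
    rw [abs_mul]
    gcongr

/-! ### Convergence in probability along a filter -/

/-- The filter of events depending on `n` whose probability tends to `1`. -/
def inProbability {Ω : Type*} [MeasurableSpace Ω] (P : Measure Ω) : Filter (ℕ × Ω) where
  sets := {S | Tendsto (fun n : ℕ => P {ω | (n, ω) ∉ S}) atTop (𝓝 0)}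
  univ_sets := by simp
  sets_of_superset {S T} hS hST :=
    tendsto_of_tendsto_of_tendsto_of_le_of_le tendsto_const_nhds hS (fun _ => zero_le)
      fun n => measure_mono fun ω (hω : (n, ω) ∉ T) (h : (n, ω) ∈ S) => hω (hST h)
  inter_sets {S T} hS hT := by
    have h := Tendsto.add hS hT
    rw [add_zero] at h
    refine tendsto_of_tendsto_of_tendsto_of_le_of_le tendsto_const_nhds h (fun _ => zero_le)
      fun n => (measure_mono ?_).trans (measure_union_le _ _)
    intro ω (hω : (n, ω) ∉ S ∩ T)
    by_cases h : (n, ω) ∈ S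
    · exact Or.inr fun h' => hω ⟨h, h'⟩
    · exact Or.inl h

lemma tendstoInProbability_iff_tendsto {Ω E : Type*} [MeasurableSpace Ω] [TopologicalSpace E]
    {P : Measure Ω} {M : ℕ → Ω → E} {m : E} :
    TendstoInProbability P M m ↔ Tendsto (fun p : ℕ × Ω => M p.1 p.2) (inProbability P) (𝓝 m) :=
  Iff.rfl

/-- Since convergence in probability is convergence along a filter, the test-function criterion for
weak convergence applies verbatim. -/
lemma tendstoInProbability_finiteMeasure_iff {Ω : Type*} [MeasurableSpace Ω] {P : Measure Ω}
    {M : ℕ → Ω → FiniteMeasure ℂ} {m : FiniteMeasure ℂ} :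
    TendstoInProbability P M m ↔ ∀ f : BoundedContinuousFunction ℂ ℝ,
      TendstoInProbability P (fun n ω => ∫ w, f w ∂(M n ω : Measure ℂ))
        (∫ w, f w ∂(m : Measure ℂ)) := by
  simp only [tendstoInProbability_iff_tendsto]
  exact FiniteMeasure.tendsto_iff_forall_integral_tendsto

lemma eventually_add_mul_log_le {a b ε : ℝ} (hε : 0 < ε) :
    ∀ᶠ x : ℝ in atTop, a * Real.log x + b ≤ ε * x := by
  have h1 := (Real.isLittleO_log_id_atTop.const_mul_left a).add
    (Asymptotics.isLittleO_const_id_atTop b)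
  filter_upwards [h1.def hε, eventually_ge_atTop 0] with x hx hx0
  simp only [id, Real.norm_eq_abs, abs_of_nonneg hx0] at hx
  exact (le_abs_self _).trans hx

lemma exists_pi_measure_not_forall_norm_le {k : ℕ} (m : Measure (Fin k → ℂ)) [IsFiniteMeasure m]
    {η : ENNReal} (hη : 0 < η) : ∃ K : ℝ, 0 ≤ K ∧ m {x | ¬ ∀ j, ‖x j‖ ≤ K} ≤ η := by
  obtain ⟨S, hS, hSm⟩ := isTightMeasureSet_iff_exists_isCompact_measure_compl_le.1
    (isTightMeasureSet_singleton_of_innerRegular (μ := m)) η hη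
  obtain ⟨K, hK⟩ := hS.isBounded.subset_closedBall 0
  refine ⟨max K 0, le_max_right _ _, (measure_mono ?_).trans (hSm m rfl)⟩
  intro x hx hxS
  refine hx fun j => (norm_le_pi_norm x j).trans ((le_max_left _ _).trans' ?_)
  simpa using hK hxS

/-! ### The convergence theorem -/

/-- The polynomial whose roots are the first `n` terms of a sequence. -/
def initialPoly (z : ℕ → ℂ) (n : ℕ) : ℂ[X] := ∏ i ∈ Finset.range n, (X - C (z i))

lemma monic_initialPoly (z : ℕ → ℂ) (n : ℕ) : (initialPoly z n).Monic :=
  monic_prod_X_sub_C _ _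

lemma natDegree_initialPoly (z : ℕ → ℂ) (n : ℕ) : (initialPoly z n).natDegree = n := by
  rw [initialPoly, natDegree_finsetProd_X_sub_C_eq_card, Finset.card_range]

lemma roots_initialPoly (z : ℕ → ℂ) (n : ℕ) :
    (initialPoly z n).roots = (Multiset.range n).map z := by
  have := roots_multiset_prod_X_sub_C ((Multiset.range n).map z)
  rwa [Multiset.map_map] at this

lemma sum_posLog_roots_addRoots_initialPoly_le {z : ℕ → ℂ} {A : ℝ}
    (hA : ∀ n : ℕ, (1 / (n : ℝ)) * ∑ i ∈ Finset.range n, Real.posLog ‖z i‖ ≤ A) {n k : ℕ}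
    {x : Fin k → ℂ} {K : ℝ} (hx : ∀ j, ‖x j‖ ≤ K) :
    ((addRoots (initialPoly z n) x).roots.map fun w => Real.posLog ‖w‖).sum ≤
      A * n + k * Real.posLog K := by
  rw [roots_addRoots (monic_initialPoly z n), roots_initialPoly, Multiset.map_add,
    Multiset.sum_add]
  refine add_le_add ?_ ?_
  · rw [Multiset.map_map]
    change ∑ i ∈ Finset.range n, Real.posLog ‖z i‖ ≤ _
    rcases Nat.eq_zero_or_pos n with rfl | hn
    · simp
    · have hn' : (0 : ℝ) < n := by exact_mod_cast hn
      have := hA n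
      rw [one_div, inv_mul_le_iff₀ hn'] at this
      linarith
  · rw [Multiset.map_map]
    change ∑ j : Fin k, Real.posLog ‖x j‖ ≤ _
    calc _ ≤ ∑ _j : Fin k, Real.posLog K :=
          Finset.sum_le_sum fun j _ => Real.posLog_le_posLog (norm_nonneg _) (hx j)
      _ = _ := by simp

/-- The main convergence statement on the product space of the added roots. -/
lemma tendstoInProbability_pi {μ : ProbabilityMeasure ℂ} {z : ℕ → ℂ}
    (hz_bdd : LogCesaroBounded z) (hz_dist : IsDistributedAs z μ) {k : ℕ}
    (ν : Fin k → Measure ℂ) [∀ j, IsProbabilityMeasure (ν j)] {A : ENNReal} (hA : A ≠ ⊤)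
    (hν : ∀ j S, ν j S ≤ A * volume S) {ℓ : ℕ} (hℓ : ℓ ≤ k) :
    TendstoInProbability (Measure.pi ν)
      (fun n x => zeroMeasure (derivative^[ℓ] (addRoots (initialPoly z n) x)))
      μ.toFiniteMeasure := by
  rw [tendstoInProbability_finiteMeasure_iff]
  intro f U hU
  obtain ⟨e, he, heU⟩ := Metric.mem_nhds_iff.1 hU
  rw [ENNReal.tendsto_nhds_zero]
  intro η hη
  have hη2 : 0 < η / 2 := ENNReal.half_pos hη.ne'
  have hB : ∀ w, |f w| ≤ ‖f‖ := fun w => f.norm_coe_le_norm w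
  set B := ‖f‖
  obtain ⟨L, hL⟩ := hz_bdd
  have hL0 : 0 ≤ L := by simpa using hL 0
  obtain ⟨K, hK0, hK⟩ := exists_pi_measure_not_forall_norm_le (Measure.pi ν) hη2
  have hpK : 0 ≤ Real.posLog K := Real.posLog_nonneg
  have hlog2 : 0 < Real.log 2 := Real.log_pos one_lt_two
  -- In the moment constant, `L + k * log₊ K` comes from the roots of `p`, and `ℓ + log 2` from
  -- passing to the derivative. The tolerance `e / 8` becomes `e / 4` because `N ≤ 2 * n`.
  obtain ⟨R, ε, κ, hε, hκ, hcomp⟩ := exists_abs_sum_sub_sum_le_of_logPot f.continuous hB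
    (show 0 < e / 8 by positivity)
    (show 0 ≤ L + k * Real.posLog K + ℓ + Real.log 2 by positivity)
  obtain ⟨c, hc0, hc⟩ := exists_setIntegral_norm_sub_inv_le R
  obtain ⟨δ, hδ, hδH⟩ := exists_pi_measure_volume_le ν hA hν hℓ K R (κ := ENNReal.ofReal (κ / 2))
    hη2.ne' (by simpa using hκ) ENNReal.ofReal_ne_top
  have hcast : Tendsto (fun n : ℕ => ((n + k : ℕ) : ℝ)) atTop atTop :=
    tendsto_natCast_atTop_atTop.comp (tendsto_add_atTop_nat k)
  have hdist := (FiniteMeasure.tendsto_iff_forall_integral_tendsto.1 hz_dist f).eventually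
    (Metric.ball_mem_nhds _ (show 0 < e / 4 by positivity))
  have hBk : Tendsto (fun n : ℕ => 2 * (B * k) / (n : ℝ)) atTop (𝓝 0) :=
    tendsto_const_nhds.div_atTop tendsto_natCast_atTop_atTop
  filter_upwards [hdist, hBk.eventually_le_const (show 0 < e / 4 by positivity),
    eventually_ge_atTop 1, eventually_ge_atTop k,
    hcast.eventually (eventually_add_mul_log_le (a := ℓ * 2) (b := 0) hε),
    hcast.eventually (eventually_add_mul_log_le (a := ℓ)
      (b := k * Real.log (max 1 (R + K)) - Real.log δ) hε),
    hcast.eventually (eventually_add_mul_log_le (a := 0) (b := c) (half_pos hκ))]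
    with n hn1 hn2 hn3 hn4 hn5 hn6 hn7
  set q := initialPoly z n with hq
  have hqm : q.Monic := monic_initialPoly z n
  have hqn : q.natDegree = n := natDegree_initialPoly z n
  refine (measure_mono (t := {x | ¬ ∀ j, ‖x j‖ ≤ K} ∪ {x | (∀ j, ‖x j‖ ≤ K) ∧
    ENNReal.ofReal (κ / 2) ≤ volume {z ∈ Metric.closedBall (0 : ℂ) R |
        ‖(derivative^[ℓ] (addRoots q x)).eval z‖ < δ * ‖q.eval z‖}}) ?_).trans
    ((measure_union_le _ _).trans ((add_le_add hK (hδH q hqm.ne_zero)).trans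
      (ENNReal.add_halves η).le))
  intro x hxU
  by_contra hcon
  simp only [Set.mem_union, not_or] at hcon
  obtain ⟨hx1, hx2⟩ := hcon
  have hx : ∀ j, ‖x j‖ ≤ K := not_not.1 hx1
  have hvol : volume.real {z ∈ Metric.closedBall (0 : ℂ) R |
      ‖(derivative^[ℓ] (addRoots q x)).eval z‖ < δ * ‖q.eval z‖} ≤ κ / 2 := by
    by_contra h
    exact hx2 ⟨hx, (ENNReal.ofReal_le_ofReal (not_le.1 h).le).trans ENNReal.ofReal_toReal_le⟩
  refine hxU (heU ?_)
  set N : ℝ := ((n + k : ℕ) : ℝ) with hN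
  have hNnk : N = n + k := by rw [hN]; push_cast; rfl
  have hn3' : (1 : ℝ) ≤ n := by exact_mod_cast hn3
  have hn4' : (k : ℝ) ≤ n := by exact_mod_cast hn4
  have hN1 : 1 ≤ N := by linarith [(Nat.cast_nonneg k : (0 : ℝ) ≤ k)]
  have hbad := volume_setOf_logPot_le (ε := ε) (κ := κ) hqm hℓ hx hc hδ (by rw [hqn]) hN1 (by linarith)
    (by linarith) (by linarith) hvol
  set p := addRoots q x with hp
  have hpm : p.Monic := monic_addRoots hqm x
  have hpn : p.natDegree = n + k := by rw [hp, natDegree_addRoots hqm, hqn]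
  have hpcard : p.roots.card = n + k := by
    rw [← (IsAlgClosed.splits p).natDegree_eq_card_roots, hpn]
  have hdcard : (derivative^[ℓ] p).roots.card = n + k - ℓ := by
    rw [card_roots_iterate_derivative, hpn]
  have hsum1 : (p.roots.map fun w => Real.posLog ‖w‖).sum ≤ L * n + k * Real.posLog K :=
    sum_posLog_roots_addRoots_initialPoly_le hL hx
  have hsum2 := sum_posLog_roots_iterate_derivative_le hpm (show ℓ ≤ p.natDegree by omega)
  rw [hpn] at hsum2
  have hlogN : Real.log N ≤ N := Real.log_le_self (by linarith)
  have hLn : L * n ≤ L * N := by gcongr; linarith [(Nat.cast_nonneg k : (0 : ℝ) ≤ k)]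
  have hkK : k * Real.posLog K ≤ k * Real.posLog K * N := le_mul_of_one_le_right (by positivity) hN1
  have hℓN : ℓ * Real.log N ≤ ℓ * N := by gcongr
  have hAN : |((derivative^[ℓ] p).roots.map f).sum - (p.roots.map f).sum| ≤ e / 8 * N := by
    refine hcomp N _ _ ?_ ?_ ?_ ?_ hbad
    · rw [hdcard, hN]; exact_mod_cast Nat.sub_le _ _
    · rw [hpcard]
    · calc _ ≤ _ := hsum2
        _ ≤ _ := by rw [← hN]; linarith
    · have h1 : 0 ≤ (ℓ : ℝ) * N := by positivity
      have h2 : 0 ≤ Real.log 2 * N := by positivity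
      linarith
  have hzk : |(p.roots.map f).sum - (((Multiset.range n).map z).map f).sum| ≤ B * k := by
    rw [hp, roots_addRoots hqm, hq, roots_initialPoly, Multiset.map_add, Multiset.sum_add,
      add_sub_cancel_left]
    simpa using abs_sum_map_le hB (Finset.univ.val.map x)
  have htot : |((derivative^[ℓ] p).roots.map f).sum - (((Multiset.range n).map z).map f).sum| ≤
      (e / 4 + B * k / n) * ((Multiset.range n).map z).card := by
    have h1 := abs_sub_le ((derivative^[ℓ] p).roots.map f).sum (p.roots.map f).sum
      (((Multiset.range n).map z).map f).sum
    have h2 : (e / 4 + B * k / n) * n = e / 4 * n + B * k := by field_simp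
    have h3 : e / 8 * N ≤ e / 8 * (2 * n) := by gcongr; linarith
    rw [Multiset.card_map, Multiset.card_range, h2]
    linarith
  have havg := abs_average_sub_average_le hB (k := k)
    (by rw [hdcard, Multiset.card_map, Multiset.card_range]; omega)
    (by rw [hdcard, Multiset.card_map, Multiset.card_range]; omega)
    (by rw [Multiset.card_map, Multiset.card_range]; omega) htot
  rw [Multiset.card_map, Multiset.card_range] at havg
  rw [Real.dist_eq, integral_uniformOnMultiset, Multiset.card_map,
    Multiset.card_range] at hn1
  rw [Metric.mem_ball, Real.dist_eq, zeroMeasure, integral_uniformOnMultiset]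
  -- Three errors below or equal to `e / 4`: the comparison of potentials, twice `B * k / n` (added
  -- roots and normalisation), and the convergence of the empirical measures.
  refine lt_of_le_of_lt (abs_sub_le _ ((n : ℝ)⁻¹ * (((Multiset.range n).map z).map f).sum) _) ?_
  have h5 : 2 * (B * k) / (n : ℝ) = B * k / n + B * k / n := by ring
  linarith

lemma HasBoundedDensity.exists_map_le {Ω : Type*} [MeasurableSpace Ω] {P : Measure Ω}
    {Y : Ω → ℂ} {f : ℂ → ℝ} (h : HasBoundedDensity P Y f) :
    ∃ A : NNReal, ∀ S, P.map Y S ≤ A * volume S := by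
  obtain ⟨B, hB⟩ := h.bounded
  refine ⟨B.toNNReal, fun S => ?_⟩
  have hle : P.map Y ≤ (B.toNNReal : ENNReal) • (volume : Measure ℂ) := by
    rw [h.law_eq, ← withDensity_const]
    exact withDensity_mono (Eventually.of_forall fun w => ENNReal.ofReal_le_ofReal (hB w))
  simpa using hle S

end

theorem mainTheorem6 {Ω : Type*} [MeasurableSpace Ω] (P : Measure Ω) [IsProbabilityMeasure P]
    (μ : ProbabilityMeasure ℂ) (z : ℕ → ℂ)
    (hz_bdd : LogCesaroBounded z) (hz_dist : IsDistributedAs z μ)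
    (k : ℕ) (X : Fin k → Ω → ℂ) (ν : Fin k → ℂ → ℝ)
    (hX_meas : ∀ j, Measurable (X j)) (hX_indep : iIndepFun X P)
    (hX_density : ∀ j, HasBoundedDensity P (X j) (ν j)) :
    TendstoInProbability P (fun n ω => zeroMeasure (addedZerosPoly z X n ω))
        μ.toFiniteMeasure ∧
      ∀ ℓ : ℕ, 1 ≤ ℓ → ℓ ≤ k →
        TendstoInProbability P
          (fun n ω => zeroMeasure (derivative^[ℓ] (addedZerosPoly z X n ω)))
          μ.toFiniteMeasure := by
  have main : ∀ ℓ ≤ k, TendstoInProbability P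
      (fun n ω => zeroMeasure (derivative^[ℓ] (addedZerosPoly z X n ω))) μ.toFiniteMeasure := by
    intro ℓ hℓ U hU
    choose A hA using fun j => (hX_density j).exists_map_le
    have hprob : ∀ j, IsProbabilityMeasure (P.map (X j)) := fun j =>
      Measure.isProbabilityMeasure_map (hX_meas j).aemeasurable
    have hlaw := (iIndepFun_iff_map_fun_eq_pi_map fun j => (hX_meas j).aemeasurable).1 hX_indep
    have hpi := tendstoInProbability_pi hz_bdd hz_dist (fun j => P.map (X j))
      (A := ((∑ j, A j : NNReal) : ENNReal)) ENNReal.coe_ne_top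
      (fun j S => (hA j S).trans (by
        gcongr
        exact Finset.single_le_sum (f := A) (fun _ _ => zero_le) (Finset.mem_univ j))) hℓ U hU
    rw [← hlaw] at hpi
    refine tendsto_of_tendsto_of_tendsto_of_le_of_le tendsto_const_nhds hpi (fun _ => zero_le)
      fun n => ?_
    -- Only this inequality is needed, and it holds for every set, so the event need not be
    -- measurable.
    exact Measure.le_map_apply (measurable_pi_lambda _ hX_meas).aemeasurable
      {x | zeroMeasure (derivative^[ℓ] (addRoots (initialPoly z n) x)) ∉ U}
  exact ⟨main 0 (Nat.zero_le k), fun ℓ _ hℓ => main ℓ hℓ⟩
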